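/- Let $(\mathcal X,\mathcal A)$ be a measurable space, $\mathcal Y=\{1,\dots,C\}$, $\Delta^C$ the probability simplex in $\mathbb R^C$, and $P$ a probability measure on $\mathcal X\times\mathcal Y$. For a column-stochastic $C\times C$ matrix $T$ let $\bar P_T$ be the law of $(X,Y,\tilde Y)$ with $\bar P_T(\mathcal S\times\{i\}\times\{j\})=T_{j,i}\,P(\mathcal S\times\{i\})$ for measurable $\mathcal S\subset\mathcal X$, and $P_T$ the marginal law of $(X,\tilde Y)$. Let $T_1,\dots,T_N$ be invertible column-stochastic matrices, $w\in\Delta^N$, $\alpha_i(c)=P_{T_i}(\tilde Y=c)$, assumed positive for all $i,c$, and $n_{i,c}\ge 1$ integers. The data $S=\{X_{i,c,j}:1\le i\le N,\ c\in\mathcal Y,\ 1\le j\le n_{i,c}\}$ are independent with $X_{i,c,j}\sim P_{T_i}(\cdot\mid c)$, the law of $X$ given $\tilde Y=c$ under $P_{T_i}$. Let $\ell$ be a real-valued loss on $\Delta^C\times\mathcal Y$ (for instance a proper loss), $\mathcal V\subset\mathbb R^C$, and $\varphi:\mathcal V\to\Delta^C$ a map (for instance the inverse $\psi^{-1}$ of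 an invertible link $\psi$). Put $\ell_T(q,c)=\ell(Tq,c)$ and $\lambda_i(v,c)=\ell_{T_i}(\varphi(v),c)$, and assume that each $\lambda_i(\cdot,c)$ is Lipschitz on $\mathcal V$ with respect to the 2-norm. Let $|\lambda_i|\ge 0$ be the smallest common Lipschitz constant of $\lambda_i(\cdot,c)$, $c\in\mathcal Y$, and $|\lambda_i|_0=\max_c|\lambda_i(0,c)|$. For $g:\mathcal X\to\mathcal V$ put $$\hat{\mathcal R}_{w,S}(g)=\sum_{i=1}^N w_i\sum_{c=1}^C\frac{\alpha_i(c)}{n_{i,c}}\sum_{j=1}^{n_{i,c}}\lambda_i(g(X_{i,c,j}),c),\qquad \widetilde{\mathcal R}(g)=\sum_{i=1}^N w_i\,\mathbb E_{(X,\tilde Y)\sim P_{T_i}}\big[\ell_{T_i}(\varphi(g(X)),\tilde Y)\big].$$ Consider two classes of functions $\mathcal X\to\mathbb R^C$. (1) $\mathcal G_1$ is the Cartesian product of $C$ copies of the closed ball of radius $R\ge 0$ in the reproducing kernel Hilbert space $\mathcal H$ of a jointly measurable symmetric positive definite kernel $k$ on $\mathcal X$ with $\|k(\cdot,x)\|_{\mathcal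 H}\le K$ for all $x$. (2) $\mathcal X\subset\mathbb R^d$ with $\|x\|_2\le a$ for all $x\in\mathcal X$, and $\mathcal G_2$ is the Cartesian product of $C$ copies of $\mathcal N_m$, $m\ge 1$, where $\mathcal N_1=\{x\mapsto\langle x,v\rangle:\|v\|_2\le\beta\}$ and, for $p\ge 2$, $\mathcal N_p=\{x\mapsto\sum_{j=1}^d v_j\,\mu(f_j(x)):v\in\mathbb R^d,\ \|v\|_1\le\beta,\ f_j\in\mathcal N_{p-1}\}$, with $\beta>0$ and $\mu:\mathbb R\to\mathbb R$ 1-Lipschitz such that $0\in\mu\circ\mathcal N_p$ for all $p\ge 1$. There are constants $B_1=B_1(K,R)$ and $B_2=B_2(a,m,\beta)$, depending on nothing else, such that the following holds for $q=1$ and $q=2$. Assume that every $g\in\mathcal G_q$ takes its values in $\mathcal V$ and that $\sup_{x\in\mathcal X,\,g\in\mathcal G_q}\|g(x)\|_2\le A_q$. Then $\mathbb E_S[\hat{\mathcal R}_{w,S}(g)]=\widetilde{\mathcal R}(g)$ for all $g\in\mathcal G_q$, and for every $\delta\in(0,1]$, with probability at least $1-\delta$, $$\sup_{g\in\mathcal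 G_q}\big|\hat{\mathcal R}_{w,S}(g)-\widetilde{\mathcal R}(g)\big|\le\Big(\max_i\big(|\lambda_i|A_q+|\lambda_i|_0\big)\sqrt{2\log\tfrac2\delta}+C\,B_q\max_i|\lambda_i|\Big)\sqrt{\sum_{i=1}^N\sum_{c=1}^C\frac{w_i^2}{n_{i,c}}}.$$ -/

import Mathlib

open MeasureTheory ProbabilityTheory

universe u v w

namespace LMNTM

noncomputable section

/-! ### Losses, the forward correction and composite losses -/

/-- A real-valued loss `ℓ(q, c)`; only its values for `q` in the probability simplex matter. -/
abbrev Loss (C : ℕ) := (Fin C → ℝ) → Fin C → ℝ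

/-- The forward correction `ℓ_T(q, c) = ℓ(T q, c)` of the loss `ℓ`. -/
def forwardCorrection {C : ℕ} (l : Loss C) (T : Matrix (Fin C) (Fin C) ℝ) : Loss C :=
  fun q c => l (T.mulVec q) c

/-- The composite loss `λ_ℓ(v, c) = ℓ(φ(v), c)`, where `φ` is the inverse of the link. -/
def compositeLoss {C : ℕ} (l : Loss C) (φ : EuclideanSpace ℝ (Fin C) → Fin C → ℝ) :
    EuclideanSpace ℝ (Fin C) → Fin C → ℝ :=
  fun v c => l (φ v) c

/-- `L` is a Lipschitz constant on `V`, with respect to the 2-norm, of `r(·, c)` for all `c`. -/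
def IsLipConst {C : ℕ} (V : Set (EuclideanSpace ℝ (Fin C)))
    (r : EuclideanSpace ℝ (Fin C) → Fin C → ℝ) (L : ℝ) : Prop :=
  0 ≤ L ∧ ∀ c, ∀ a ∈ V, ∀ b ∈ V, |r a c - r b c| ≤ L * ‖a - b‖

/-- The smallest Lipschitz constant on `V` common to all `r(·, c)`. -/
def lipConst {C : ℕ} (V : Set (EuclideanSpace ℝ (Fin C)))
    (r : EuclideanSpace ℝ (Fin C) → Fin C → ℝ) : ℝ :=
  sInf {L | IsLipConst V r L}

/-- `max_c |r(0, c)|`. -/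
def absAtZero {C : ℕ} (r : EuclideanSpace ℝ (Fin C) → Fin C → ℝ) : ℝ :=
  ⨆ c, |r 0 c|

/-! ### The label noise model -/

section Noise

variable {X : Type u} [MeasurableSpace X] {C : ℕ}

/-- The joint law of (feature, clean label, noisy label): the measure with
`A × {i} × {j} ↦ P (A × {i}) * T j i`. -/
def jointNoisy (P : Measure (X × Fin C)) (T : Matrix (Fin C) (Fin C) ℝ) :
    Measure (X × Fin C × Fin C) :=
  ∑ i, ∑ j, ENNReal.ofReal (T j i) •
    (P.restrict (Prod.snd ⁻¹' {i})).map (fun z => (z.1, z.2, j))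

/-- `P_T`, the law of (feature, noisy label). -/
def noisy (P : Measure (X × Fin C)) (T : Matrix (Fin C) (Fin C) ℝ) : Measure (X × Fin C) :=
  (jointNoisy P T).map (fun z => (z.1, z.2.2))

/-- The noisy prior `α(c) = P_T(noisy label = c)`. -/
def noisyPrior (P : Measure (X × Fin C)) (T : Matrix (Fin C) (Fin C) ℝ) (c : Fin C) : ℝ :=
  (noisy P T).real (Prod.snd ⁻¹' {c})

/-- The class conditional law `P_T(· | c)` of the feature given that the noisy label is `c`. -/
def classCond (P : Measure (X × Fin C)) (T : Matrix (Fin C) (Fin C) ℝ) (c : Fin C) :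
    Measure X :=
  (ProbabilityTheory.cond (noisy P T) (Prod.snd ⁻¹' {c})).map Prod.fst

/-- The `L`-risk `E_Q[L(f(X), Y)]`. -/
def risk (L : Loss C) (Q : Measure (X × Fin C)) (f : X → Fin C → ℝ) : ℝ :=
  ∫ z, L (f z.1) z.2 ∂Q

end Noise

/-! ### Learning with multiple noise transition matrices -/

/-- The data of the problem: a clean distribution `P`, noise transition matrices `T i`, weights
`w`, sample sizes `n i c`, a loss `l`, and the inverse `φ : V → Δ^C` of the link function, for a
set `V ⊆ ℝ^C`. The loss need not be proper and `φ` need not be injective: the log loss, which is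
infinite on part of the boundary of the simplex, and the softmax map on all of `ℝ^C`, which is
constant along the diagonal, are included in this way. -/
structure Setting (X : Type u) [MeasurableSpace X] (C N : ℕ) where
  P : Measure (X × Fin C)
  isProb : IsProbabilityMeasure P
  T : Fin N → Matrix (Fin C) (Fin C) ℝ
  stochastic : ∀ i, T i ∈ Matrix.colStochastic ℝ (Fin C)
  invertible : ∀ i, IsUnit (T i)
  prior_pos : ∀ i c, 0 < noisyPrior P (T i) c
  w : Fin N → ℝ
  w_mem : w ∈ stdSimplex ℝ (Fin N)
  n : Fin N → Fin C → ℕ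
  n_pos : ∀ i c, 0 < n i c
  l : Loss C
  V : Set (EuclideanSpace ℝ (Fin C))
  φ : EuclideanSpace ℝ (Fin C) → Fin C → ℝ
  φ_mem : ∀ v ∈ V, φ v ∈ stdSimplex ℝ (Fin C)
  lipschitz : ∀ i c, ∃ L : ℝ, ∀ a ∈ V, ∀ b ∈ V,
    |compositeLoss (forwardCorrection l (T i)) φ a c
      - compositeLoss (forwardCorrection l (T i)) φ b c| ≤ L * ‖a - b‖

namespace Setting

variable {X : Type u} [MeasurableSpace X] {C N : ℕ} (M : Setting X C N)

/-- The prior `α_i(c)` of the noisy labels under `P_{T_i}`. -/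
def α (i : Fin N) (c : Fin C) : ℝ := noisyPrior M.P (M.T i) c

/-- The composite loss `λ_{ℓ_{T_i}}`. -/
def lam (i : Fin N) : EuclideanSpace ℝ (Fin C) → Fin C → ℝ :=
  compositeLoss (forwardCorrection M.l (M.T i)) M.φ

/-- The indices `(i, c, j)` of the data points. -/
abbrev Index : Type := (i : Fin N) × (c : Fin C) × Fin (M.n i c)

/-- The empirical risk of `f : X → Δ^C` on the data points `S`. -/
def empRiskF (S : M.Index → X) (f : X → Fin C → ℝ) : ℝ :=
  ∑ i, M.w i * ∑ c, M.α i c / (M.n i c : ℝ) *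
    ∑ j : Fin (M.n i c), forwardCorrection M.l (M.T i) (f (S ⟨i, c, j⟩)) c

/-- The aggregate risk of `f : X → Δ^C`. -/
def aggRiskF (f : X → Fin C → ℝ) : ℝ :=
  ∑ i, M.w i * risk (forwardCorrection M.l (M.T i)) (noisy M.P (M.T i)) f

/-- The empirical risk of `g : X → V`, that is, of `φ ∘ g`. -/
def empRisk (S : M.Index → X) (g : X → EuclideanSpace ℝ (Fin C)) : ℝ :=
  M.empRiskF S (fun x => M.φ (g x))

/-- The aggregate risk of `g : X → V`, that is, of `φ ∘ g`. -/
def aggRisk (g : X → EuclideanSpace ℝ (Fin C)) : ℝ :=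
  M.aggRiskF (fun x => M.φ (g x))

/-- The data points are independent, and the one with index `(i, c, j)` has law
`P_{T_i}(· | c)`. -/
structure IsSample {Ω : Type w} [MeasurableSpace Ω] (Pr : Measure Ω)
    (S : M.Index → Ω → X) : Prop where
  measurable : ∀ s, Measurable (S s)
  law : ∀ s, Pr.map (S s) = classCond M.P (M.T s.1) s.2.1
  indep : iIndepFun S Pr

/-- The right-hand side of the generalization error bound. -/
def bound (A B δ : ℝ) : ℝ :=
  ((⨆ i, (lipConst M.V (M.lam i) * A + absAtZero (M.lam i))) * Real.sqrt (2 * Real.log (2 / δ))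
      + C * B * ⨆ i, lipConst M.V (M.lam i))
    * Real.sqrt (∑ i, ∑ c, M.w i ^ 2 / (M.n i c : ℝ))

end Setting

/-! ### Function classes -/

/-- The Cartesian product of `C` copies of a class of real-valued functions, as a class of
functions with values in `ℝ^C`. -/
def productClass {X : Type u} (C : ℕ) (F : Set (X → ℝ)) : Set (X → EuclideanSpace ℝ (Fin C)) :=
  {g | ∀ c, (fun x => g x c) ∈ F}

/-- The ball of radius `R` in a reproducing kernel Hilbert space `H` of real functions on `X`. -/
def rkhsBall {X : Type u} (H : Type v) [NormedAddCommGroup H] [InnerProductSpace ℝ H]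
    [RKHS ℝ H X ℝ] (R : ℝ) : Set (X → ℝ) :=
  {f | ∃ h : H, ‖h‖ ≤ R ∧ ∀ x, f x = h x}

/-- The real-valued multilayer perceptrons with `m ≥ 1` layers on a set `D ⊆ ℝ^d` of inputs, with
activation function `μ` and weight bound `β`. The value at `m = 0` is not used. -/
def mlp {d : ℕ} (D : Set (EuclideanSpace ℝ (Fin d))) (μ : ℝ → ℝ) (β : ℝ) : ℕ → Set (D → ℝ)
  | 0 => ∅
  | 1 => {f | ∃ v : EuclideanSpace ℝ (Fin d), ‖v‖ ≤ β ∧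
      ∀ x : D, f x = inner ℝ (x : EuclideanSpace ℝ (Fin d)) v}
  | m + 2 => {f | ∃ (v : Fin d → ℝ) (h : Fin d → D → ℝ), ∑ j, |v j| ≤ β ∧
      (∀ j, h j ∈ mlp D μ β (m + 1)) ∧ ∀ x, f x = ∑ j, v j * μ (h j x)}

end

end LMNTM

/-!
The empirical risk is a sum of independent terms, one for each data point, with weights
`w_i α_i(c) / n_{i,c}`, and its mean is the aggregate risk, because a risk is the mean of the class
conditional risks weighted by the priors (`Setting.integral_empRisk`). The bound is a
combination of McDiarmid's inequality and a Rademacher average.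

The uniform deviation `sup_g |R̂(g) - R̃(g)|` need not be measurable: a reproducing kernel Hilbert
space with a measurable kernel can be non-separable. It is therefore replaced by `meanMaxDiff`, the
mean over an independent second sample `S'` of `maxDiff`, the supremum of `|R̂_S(g) - R̂_{S'}(g)|`.
This function bounds the uniform deviation pointwise and has the same bounded differences, so that
McDiarmid's inequality applies to it without loss in the constant, and its mean is the quantity that
symmetrization bounds. It is measurable as soon as `maxDiff` is. For perceptrons `maxDiff` is lower
semicontinuous. For a Hilbert space ball it depends only on the Gram matrix of the sample points: by
orthogonal projection, the values of the class at finitely many points are those of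
combinations of the kernel functions at these points, and countably many coefficients suffice.

The mean of `maxDiff` over random exchanges of points between the two samples is bounded by
Rademacher averages (`expect_maxDiff_signedSwap_le`). The contraction principle
(`RadLE.contraction`), with Khintchine's inequality for Lipschitz functions of vectors
(`RadLE.vector_contraction`), replaces the losses by the coordinates of `g`, and the `C` coordinates
of a product class contribute separately (`RadLE.sum_coord`). What remains are the Rademacher
averages of the real-valued classes: for a ball, and for the linear first layer, they are bounded by
the second moment of a random sum of vectors (`RadLE.of_inner`), and each further layer costs a
factor `2 β` (`radLE_mlp`).

A Rademacher average involves finitely many sign vectors. The predicate `RadLE` bounds the average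
for all selections of a member of the class for each sign vector, instead of the average of the
suprema over the class, so that no boundedness conditions are needed.
-/

namespace LMNTM

open Finset Function
open scoped BigOperators

/-! ### Rademacher averages -/

/-- The real number `1` or `-1` given by a sign. Random signs are averages over `ι → ℤˣ`. -/
def sgn (u : ℤˣ) : ℝ := ((u : ℤ) : ℝ)

@[simp] lemma sgn_one : sgn 1 = 1 := by simp [sgn]
@[simp] lemma sgn_neg (u : ℤˣ) : sgn (-u) = -sgn u := by simp [sgn]
@[simp] lemma abs_sgn (u : ℤˣ) : |sgn u| = 1 := by
  rcases Int.units_eq_one_or u with rfl | rfl <;> simp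

lemma expect_sign (f : ℤˣ → ℝ) : 𝔼 u, f u = (f 1 + f (-1)) / 2 := by
  rw [Fintype.expect_eq_sum_div_card]
  have : (univ : Finset ℤˣ) = {1, -1} := rfl
  simp [this]

lemma expect_neg_arg {κ : Type*} [Fintype κ] [InvolutiveNeg κ] (f : κ → ℝ) :
    𝔼 k, f (-k) = 𝔼 k, f k :=
  Fintype.expect_equiv (Equiv.neg κ) _ _ fun _ => rfl

lemma sum_sgn_update {ι E : Type*} [DecidableEq ι] [AddCommGroup E] [Module ℝ E]
    {S : Finset ι} {i : ι} (hi : i ∉ S) (ε : ι → ℤˣ) (τ : ℤˣ) (x : ι → E) :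
    ∑ s ∈ insert i S, sgn (update ε i τ s) • x s = sgn τ • x i + ∑ s ∈ S, sgn (ε s) • x s := by
  rw [sum_insert hi, update_self]
  congr 1
  refine sum_congr rfl fun s hs => ?_
  rw [update_of_ne (ne_of_mem_of_not_mem hs hi)]

section Moments

variable {ι κ : Type*} [Fintype ι] [DecidableEq ι] [Fintype κ] [Nonempty κ]

/-- Resampling one coordinate of a uniformly distributed family does not change its law. -/
lemma expect_update (f : (ι → κ) → ℝ) (i : ι) :
    𝔼 σ, f σ = 𝔼 σ : ι → κ, 𝔼 τ, f (update σ i τ) := by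
  have key : ∀ g : (ι → κ) → ℝ, 𝔼 σ, g σ =
      𝔼 p : κ × ({j // j ≠ i} → κ), g ((Equiv.funSplitAt i κ).symm p) := fun g =>
    Fintype.expect_equiv (Equiv.funSplitAt i κ) _ _ fun σ => by
      rw [Equiv.symm_apply_apply]
  have hup : ∀ (k τ : κ) (ρ : {j // j ≠ i} → κ),
      update ((Equiv.funSplitAt i κ).symm (k, ρ)) i τ = (Equiv.funSplitAt i κ).symm (τ, ρ) := by
    intro k τ ρ
    ext j
    by_cases h : j = i <;> simp [h, update, Equiv.funSplitAt, Equiv.piSplitAt]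
  rw [key f, key (fun σ => 𝔼 τ, f (update σ i τ)), ← univ_product_univ, expect_product,
    expect_product]
  simp only [hup]
  rw [expect_comm, Fintype.expect_const, expect_comm]

variable {E : Type*} [NormedAddCommGroup E] [InnerProductSpace ℝ E]

lemma expect_norm_sq (S : Finset ι) (x : ι → E) :
    𝔼 ε : ι → ℤˣ, ‖∑ s ∈ S, sgn (ε s) • x s‖ ^ 2 = ∑ s ∈ S, ‖x s‖ ^ 2 := by
  induction S using Finset.induction_on with
  | empty => simp
  | insert i S hi ih =>
    rw [expect_update _ i, sum_insert hi, ← ih]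
    simp only [sum_sgn_update hi]
    rw [← Fintype.expect_const (ι := ι → ℤˣ) (‖x i‖ ^ 2), ← expect_add_distrib]
    refine expect_congr rfl fun ε _ => ?_
    rw [expect_sign]
    simp only [sgn_one, sgn_neg, one_smul, neg_smul, norm_add_sq_real, inner_neg_left, norm_neg]
    ring

lemma expect_pow_four (S : Finset ι) (x : ι → ℝ) :
    𝔼 ε : ι → ℤˣ, (∑ s ∈ S, sgn (ε s) • x s) ^ 4 ≤ 3 * (∑ s ∈ S, x s ^ 2) ^ 2 := by
  induction S using Finset.induction_on with
  | empty => simp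
  | insert i S hi ih =>
    have h2 := expect_norm_sq S x
    simp only [Real.norm_eq_abs, sq_abs] at h2
    rw [expect_update _ i, sum_insert hi]
    simp only [sum_sgn_update hi]
    have : ∀ ε : ι → ℤˣ, 𝔼 τ, (sgn τ • x i + ∑ s ∈ S, sgn (ε s) • x s) ^ 4 =
        (∑ s ∈ S, sgn (ε s) • x s) ^ 4 + (6 * x i ^ 2) * (∑ s ∈ S, sgn (ε s) • x s) ^ 2
          + x i ^ 4 := by
      intro ε
      rw [expect_sign]
      simp only [sgn_one, sgn_neg, one_smul, neg_smul]
      ring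
    simp only [this, expect_add_distrib, ← mul_expect, h2, Fintype.expect_const]
    nlinarith [sq_nonneg (x i ^ 2)]

/-- **Khintchine's inequality**, with a constant that is not optimal. It follows from the second
and fourth moments, because `x N³ ≥ x² N² - (4/27) x⁴` for `x, N ≥ 0`. -/
lemma khintchine (x : ι → ℝ) :
    √(∑ s, x s ^ 2) ≤ 2 * 𝔼 ε : ι → ℤˣ, |∑ s, sgn (ε s) * x s| := by
  set N := √(∑ s, x s ^ 2) with hN
  have hN0 : 0 ≤ N := Real.sqrt_nonneg _
  have hN2 : N ^ 2 = ∑ s, x s ^ 2 := Real.sq_sqrt (sum_nonneg fun s _ => sq_nonneg _)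
  have h2 := expect_norm_sq univ x
  have h4 := expect_pow_four univ x
  simp only [Real.norm_eq_abs, sq_abs, smul_eq_mul] at h2 h4
  rw [← hN2] at h2 h4
  have hpt : ∀ ε : ι → ℤˣ, N ^ 2 * (∑ s, sgn (ε s) * x s) ^ 2
      - 4 / 27 * (∑ s, sgn (ε s) * x s) ^ 4 ≤ N ^ 3 * |∑ s, sgn (ε s) * x s| := by
    intro ε
    set z := ∑ s, sgn (ε s) * x s
    have hz := abs_nonneg z
    have e2 : z ^ 2 = |z| ^ 2 := (sq_abs z).symm
    have e4 : z ^ 4 = |z| ^ 4 := by rw [show (4 : ℕ) = 2 * 2 from rfl, pow_mul, pow_mul, e2]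
    rw [e2, e4]
    nlinarith [mul_nonneg hz (mul_nonneg (sq_nonneg (|z| - 3 * N / 2))
      (by positivity : 0 ≤ |z| + 3 * N))]
  have h := expect_le_expect (s := univ) fun ε (_ : ε ∈ univ) => hpt ε
  rw [expect_sub_distrib, ← mul_expect, ← mul_expect, ← mul_expect, h2] at h
  rcases hN0.eq_or_lt with h0 | h0
  · rw [← h0]
    have : 0 ≤ 𝔼 ε : ι → ℤˣ, |∑ s, sgn (ε s) * x s| := expect_nonneg fun _ _ => abs_nonneg _
    positivity
  · have h3 : 0 < N ^ 3 := by positivity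
    refine le_of_mul_le_mul_left ?_ h3
    nlinarith

end Moments

section Contraction

variable {ι κ κ₂ J T : Type*} [Fintype ι] [DecidableEq ι]

/-- The Rademacher average `𝔼_ε sup_t ∑_s ε_s φ_s(t)` is at most `D`. As there are finitely many
sign vectors, the supremum is replaced by all selections `ε ↦ t(ε)`, so that no boundedness
of `φ` is needed. -/
def RadLE (φ : ι → T → ℝ) (D : ℝ) : Prop :=
  ∀ t : (ι → ℤˣ) → T, 𝔼 ε : ι → ℤˣ, ∑ s, sgn (ε s) * φ s (t ε) ≤ D

/-- Suprema of random sums may be compared by comparing the summands one at a time. -/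
lemma expect_iSup_sum_le [Fintype κ] [Nonempty κ] {Ψ₁ Ψ₂ : ι → κ → J → ℝ}
    (h : ∀ s (F : J → ℝ), 𝔼 k, ⨆ j, (F j + Ψ₁ s k j) ≤ 𝔼 k, ⨆ j, (F j + Ψ₂ s k j)) :
    𝔼 σ : ι → κ, ⨆ j, ∑ s, Ψ₁ s (σ s) j ≤ 𝔼 σ : ι → κ, ⨆ j, ∑ s, Ψ₂ s (σ s) j := by
  have key : ∀ S : Finset ι, 𝔼 σ : ι → κ, ⨆ j, ∑ s, Ψ₁ s (σ s) j ≤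
      𝔼 σ : ι → κ, ⨆ j, ∑ s, (if s ∈ S then Ψ₂ s (σ s) j else Ψ₁ s (σ s) j) := by
    intro S
    induction S using Finset.induction_on with
    | empty => simp
    | insert i S hi ih =>
      refine ih.trans ?_
      rw [expect_update _ i, expect_update (fun σ : ι → κ => ⨆ j,
        ∑ s, (if s ∈ insert i S then Ψ₂ s (σ s) j else Ψ₁ s (σ s) j)) i]
      refine expect_le_expect fun σ _ => ?_
      have e₁ : ∀ τ j, ∑ s, (if s ∈ S then Ψ₂ s (update σ i τ s) j else Ψ₁ s (update σ i τ s) j)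
          = (∑ s ∈ univ.erase i, (if s ∈ S then Ψ₂ s (σ s) j else Ψ₁ s (σ s) j))
            + Ψ₁ i τ j := by
        intro τ j
        rw [← sum_erase_add _ _ (mem_univ i)]
        congr 1
        · refine sum_congr rfl fun s hs => ?_
          rw [update_of_ne (ne_of_mem_erase hs)]
        · rw [if_neg hi, update_self]
      have e₂ : ∀ τ j, ∑ s, (if s ∈ insert i S then Ψ₂ s (update σ i τ s) j
          else Ψ₁ s (update σ i τ s) j)
          = (∑ s ∈ univ.erase i, (if s ∈ S then Ψ₂ s (σ s) j else Ψ₁ s (σ s) j))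
            + Ψ₂ i τ j := by
        intro τ j
        rw [← sum_erase_add _ _ (mem_univ i)]
        congr 1
        · refine sum_congr rfl fun s hs => ?_
          rw [update_of_ne (ne_of_mem_erase hs)]
          simp [ne_of_mem_erase hs]
        · rw [if_pos (mem_insert_self _ _), update_self]
      simp only [e₁, e₂]
      exact h i _
  simpa using key univ

lemma expect_fst [Fintype κ] [Nonempty κ] [Fintype κ₂] [Nonempty κ₂] (f : (ι → κ) → ℝ) :
    𝔼 σ : ι → κ × κ₂, f (fun s => (σ s).1) = 𝔼 σ, f σ := by
  refine (Fintype.expect_equiv (Equiv.arrowProdEquivProdArrow ι (fun _ => κ) fun _ => κ₂)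
    _ (fun p => f p.1) fun σ => rfl).trans ?_
  rw [← univ_product_univ, expect_product]
  simp

lemma expect_snd [Fintype κ] [Nonempty κ] [Fintype κ₂] [Nonempty κ₂] (f : (ι → κ₂) → ℝ) :
    𝔼 σ : ι → κ × κ₂, f (fun s => (σ s).2) = 𝔼 σ, f σ := by
  refine (Fintype.expect_equiv (Equiv.arrowProdEquivProdArrow ι (fun _ => κ) fun _ => κ₂)
    _ (fun p => f p.2) fun σ => rfl).trans ?_
  rw [← univ_product_univ, expect_product]
  simp

/-- One step of the contraction principle: `ε f` is replaced by the odd random function `Ψ`. -/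
lemma expect_iSup_contraction [Fintype κ] [Nonempty κ] [InvolutiveNeg κ] [Finite J] [Nonempty J]
    {f : J → ℝ} {Ψ : κ → J → ℝ} (hodd : ∀ k j, Ψ (-k) j = -Ψ k j)
    (hf : ∀ j j', |f j - f j'| ≤ 𝔼 k, |Ψ k j - Ψ k j'|) (F : J → ℝ) :
    𝔼 u, ⨆ j, (F j + sgn u * f j) ≤ 𝔼 k, ⨆ j, (F j + Ψ k j) := by
  have hb : ∀ g : J → ℝ, BddAbove (Set.range g) := fun g => (Set.finite_range g).bddAbove
  have hsymm : 𝔼 k, ⨆ j, (F j + Ψ k j) =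
      𝔼 k, ((⨆ j, (F j + Ψ k j)) + ⨆ j, (F j - Ψ k j)) / 2 := by
    rw [← expect_div, expect_add_distrib, ← expect_neg_arg fun k => ⨆ j, (F j - Ψ k j)]
    simp [hodd]
  rw [hsymm, expect_sign]
  obtain ⟨j, hj⟩ := exists_eq_ciSup_of_finite (f := fun j => F j + sgn 1 * f j)
  obtain ⟨j', hj'⟩ := exists_eq_ciSup_of_finite (f := fun j => F j + sgn (-1) * f j)
  rw [← hj, ← hj']
  simp only [sgn_one, sgn_neg]
  calc (F j + 1 * f j + (F j' + -1 * f j')) / 2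
      ≤ (F j + F j' + 𝔼 k, |Ψ k j - Ψ k j'|) / 2 := by
        linarith [le_abs_self (f j - f j'), hf j j']
    _ = 𝔼 k, (F j + F j' + |Ψ k j - Ψ k j'|) / 2 := by
        rw [← expect_div, expect_add_distrib, Fintype.expect_const]
    _ ≤ _ := by
        refine expect_le_expect fun k _ => ?_
        have h1 := le_ciSup (hb fun j => F j + Ψ k j)
        have h2 := le_ciSup (hb fun j => F j - Ψ k j)
        have := h1 j; have := h1 j'; have := h2 j; have := h2 j'
        rcases abs_cases (Ψ k j - Ψ k j') with ⟨h, _⟩ | ⟨h, _⟩ <;> rw [h] <;> linarith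

/-- The **contraction principle**: if the increments of each `φ s` are bounded by the mean
absolute increments of an odd random function `Ψ s`, then `𝔼 sup ∑ ε_s φ_s` is bounded by
`𝔼 sup ∑ Ψ_s`. -/
lemma RadLE.contraction [Fintype κ] [Nonempty κ] [InvolutiveNeg κ] {φ : ι → T → ℝ}
    {Ψ : ι → κ → T → ℝ} (hodd : ∀ s k t, Ψ s (-k) t = -Ψ s k t)
    (hφ : ∀ s t t', |φ s t - φ s t'| ≤ 𝔼 k, |Ψ s k t - Ψ s k t'|) {D : ℝ}
    (hD : ∀ t : (ι → κ) → T, 𝔼 σ : ι → κ, ∑ s, Ψ s (σ s) (t σ) ≤ D) : RadLE φ D := by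
  intro t
  -- Only the finitely many values of the selection `t` matter; they are indexed by the signs.
  have h1 : 𝔼 ε : ι → ℤˣ, ∑ s, sgn (ε s) * φ s (t ε) ≤
      𝔼 ε : ι → ℤˣ, ⨆ j, ∑ s, sgn (ε s) * φ s (t j) :=
    expect_le_expect fun ε _ =>
      le_ciSup (f := fun j => ∑ s, sgn (ε s) * φ s (t j)) (Set.finite_range _).bddAbove ε
  have h2 := expect_iSup_sum_le (ι := ι) (κ := ℤˣ × κ) (J := ι → ℤˣ)
    (Ψ₁ := fun s k j => sgn k.1 * φ s (t j)) (Ψ₂ := fun s k j => Ψ s k.2 (t j)) (by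
      intro s F
      rw [← univ_product_univ, expect_product, expect_product]
      simp only [Fintype.expect_const]
      exact expect_iSup_contraction (fun k j => hodd s k (t j)) (fun j j' => hφ s _ _) F)
  rw [expect_fst (fun ε => ⨆ j, ∑ s, sgn (ε s) * φ s (t j)),
    expect_snd (fun σ => ⨆ j, ∑ s, Ψ s (σ s) (t j))] at h2
  refine h1.trans (h2.trans ?_)
  choose j hj using fun σ : ι → κ =>
    exists_eq_ciSup_of_finite (f := fun j : ι → ℤˣ => ∑ s, Ψ s (σ s) (t j))
  simp only [← hj]
  exact hD fun σ => t (j σ)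

lemma RadLE.comp_lipschitz {φ ψ : ι → T → ℝ} (h : ∀ s t t', |φ s t - φ s t'| ≤ |ψ s t - ψ s t'|)
    {D : ℝ} (hD : RadLE ψ D) : RadLE φ D := by
  refine RadLE.contraction (κ := ℤˣ) (Ψ := fun s k t => sgn k * ψ s t) (by simp) ?_ hD
  intro s t t'
  simp only [← mul_sub, abs_mul, abs_sgn, one_mul, Fintype.expect_const]
  exact h s t t'

/-- The contraction principle for functions that are Lipschitz in the 2-norm of several
coordinates. -/
lemma RadLE.vector_contraction [Fintype κ] [DecidableEq κ] {φ : ι → T → ℝ} {ψ : ι → κ → T → ℝ}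
    (h : ∀ s t t', |φ s t - φ s t'| ≤ √(∑ c, (ψ s c t - ψ s c t') ^ 2)) {D : ℝ}
    (hD : ∀ t : (ι → κ → ℤˣ) → T, 𝔼 σ : ι → κ → ℤˣ, ∑ s, ∑ c, sgn (σ s c) * ψ s c (t σ) ≤ D) :
    RadLE φ (2 * D) := by
  refine RadLE.contraction (κ := κ → ℤˣ) (Ψ := fun s k t => 2 * ∑ c, sgn (k c) * ψ s c t) ?_ ?_ ?_
  · intro s k t
    simp
  · intro s t t'
    refine (h s t t').trans ((khintchine _).trans (le_of_eq ?_))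
    rw [mul_expect]
    refine expect_congr rfl fun k _ => ?_
    rw [← mul_sub, ← sum_sub_distrib, abs_mul, abs_two]
    simp only [mul_sub]
  · intro t
    simp only [← mul_sum, ← mul_expect]
    linarith [hD t]

/-- For a product class, the coordinates contribute separately. -/
lemma RadLE.sum_coord [Fintype κ] [DecidableEq κ] {T₀ : Type*} {φ : ι → T₀ → ℝ} {D : ℝ}
    (hD : RadLE φ D) (p : κ → T → T₀) (t : (ι → κ → ℤˣ) → T) :
    𝔼 σ : ι → κ → ℤˣ, ∑ s, ∑ c, sgn (σ s c) * φ s (p c (t σ)) ≤ Fintype.card κ * D := by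
  have h : ∀ c, 𝔼 σ : ι → κ → ℤˣ, ∑ s, sgn (σ s c) * φ s (p c (t σ)) ≤ D := by
    intro c
    refine (Fintype.expect_equiv (Equiv.piComm fun (_ : ι) (_ : κ) => ℤˣ) _
      (fun σ => ∑ s, sgn (σ c s) * φ s (p c (t fun s c => σ c s))) fun σ => rfl).trans_le ?_
    rw [expect_update _ c]
    refine expect_le univ_nonempty fun σ _ => ?_
    simp only [update_self]
    exact hD fun τ => p c (t fun s c' => update σ c τ c' s)
  simp_rw [sum_comm (γ := ι)]
  rw [expect_sum_comm]
  calc _ ≤ ∑ _c : κ, D := sum_le_sum fun c _ => h c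
    _ = _ := by simp

lemma RadLE.neg {φ : ι → T → ℝ} {D : ℝ} (hD : RadLE φ D) (t : (ι → ℤˣ) → T) :
    𝔼 ε : ι → ℤˣ, -∑ s, sgn (ε s) * φ s (t ε) ≤ D := by
  rw [← expect_neg_arg]
  simpa using hD fun ε => t (-ε)

/-- The absolute value of the Rademacher sums costs a factor `2` if `φ` vanishes somewhere. -/
lemma RadLE.expect_abs_le {φ : ι → T → ℝ} {D : ℝ} (hD : RadLE φ D) {t₀ : T}
    (h₀ : ∀ s, φ s t₀ = 0) (t : (ι → ℤˣ) → T) :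
    𝔼 ε : ι → ℤˣ, |∑ s, sgn (ε s) * φ s (t ε)| ≤ 2 * D := by
  classical
  -- `p` and `q` keep the positive and the negative sums, and replace the others by zero.
  let p : (ι → ℤˣ) → T := fun ε => if 0 ≤ ∑ s, sgn (ε s) * φ s (t ε) then t ε else t₀
  let q : (ι → ℤˣ) → T := fun ε => if 0 ≤ ∑ s, sgn (ε s) * φ s (t ε) then t₀ else t ε
  have h : ∀ ε : ι → ℤˣ, |∑ s, sgn (ε s) * φ s (t ε)| =
      ∑ s, sgn (ε s) * φ s (p ε) + -∑ s, sgn (ε s) * φ s (q ε) := by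
    intro ε
    by_cases hε : 0 ≤ ∑ s, sgn (ε s) * φ s (t ε)
    · simp [p, q, hε, h₀, abs_of_nonneg hε]
    · simp [p, q, hε, h₀, abs_of_neg (not_le.1 hε)]
  simp only [h, expect_add_distrib]
  linarith [hD p, hD.neg q]

/-- The Rademacher average of linear functionals on a ball of a Hilbert space. -/
lemma RadLE.of_inner {E : Type*} [NormedAddCommGroup E] [InnerProductSpace ℝ E] {R K : ℝ}
    (hR : 0 ≤ R) (hK : 0 ≤ K) {e : T → E} (he : ∀ t, ‖e t‖ ≤ R) {x : ι → E}
    (hx : ∀ s, ‖x s‖ ≤ K) (b : ι → ℝ) :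
    RadLE (fun s t => b s * inner ℝ (x s) (e t)) (R * K * √(∑ s, b s ^ 2)) := by
  intro t
  have h1 : ∀ ε : ι → ℤˣ, ∑ s, sgn (ε s) * (b s * inner ℝ (x s) (e (t ε))) ≤
      R * ‖∑ s, sgn (ε s) • (b s • x s)‖ := by
    intro ε
    have : ∑ s, sgn (ε s) * (b s * inner ℝ (x s) (e (t ε))) =
        inner ℝ (∑ s, sgn (ε s) • (b s • x s)) (e (t ε)) := by
      simp [sum_inner, real_inner_smul_left]
    rw [this, mul_comm]
    exact (real_inner_le_norm _ _).trans (mul_le_mul_of_nonneg_left (he _) (norm_nonneg _))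
  have h2 : (𝔼 ε : ι → ℤˣ, ‖∑ s, sgn (ε s) • (b s • x s)‖) ^ 2 ≤
      𝔼 ε : ι → ℤˣ, ‖∑ s, sgn (ε s) • (b s • x s)‖ ^ 2 := by
    simp only [Fintype.expect_eq_sum_div_card]
    have hc : (0 : ℝ) < Fintype.card (ι → ℤˣ) := by exact_mod_cast Fintype.card_pos
    rw [div_pow, div_le_div_iff₀ (by positivity) hc]
    have := sq_sum_le_card_mul_sum_sq (s := univ)
      (f := fun ε : ι → ℤˣ => ‖∑ s, sgn (ε s) • (b s • x s)‖)
    rw [card_univ] at this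
    nlinarith
  have h3 : 𝔼 ε : ι → ℤˣ, ‖∑ s, sgn (ε s) • (b s • x s)‖ ≤ K * √(∑ s, b s ^ 2) := by
    refine le_of_sq_le_sq (h2.trans ?_) (by positivity)
    rw [expect_norm_sq, mul_pow, Real.sq_sqrt (sum_nonneg fun s _ => sq_nonneg _), mul_sum]
    refine sum_le_sum fun s _ => ?_
    rw [norm_smul, mul_pow, Real.norm_eq_abs, sq_abs, mul_comm]
    exact mul_le_mul_of_nonneg_right (pow_le_pow_left₀ (norm_nonneg _) (hx s) 2) (sq_nonneg _)
  calc _ ≤ 𝔼 ε : ι → ℤˣ, R * ‖∑ s, sgn (ε s) • (b s • x s)‖ :=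
        expect_le_expect fun ε _ => h1 ε
    _ ≤ _ := by
        rw [← mul_expect, mul_assoc]
        exact mul_le_mul_of_nonneg_left h3 hR

end Contraction

/-! ### McDiarmid's inequality -/

section McDiarmid

variable {X : Type*} [MeasurableSpace X]

lemma integrable_of_abs_le {μ : Measure X} [IsFiniteMeasure μ] {f : X → ℝ} (hf : Measurable f)
    {M : ℝ} (hM : ∀ x, |f x| ≤ M) : Integrable f μ :=
  Integrable.of_bound hf.aestronglyMeasurable M (Filter.Eventually.of_forall hM)

lemma abs_integral_le_of_abs_le {μ : Measure X} [IsProbabilityMeasure μ] {f : X → ℝ} {M : ℝ}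
    (hM : ∀ x, |f x| ≤ M) : |∫ x, f x ∂μ| ≤ M := by
  simpa using norm_integral_le_of_norm_le_const (μ := μ) (f := f) (Filter.Eventually.of_forall hM)

/-- **Hoeffding's lemma** for a function with oscillation at most `c`. -/
lemma integral_exp_mul_le {μ : Measure X} [IsProbabilityMeasure μ] {g : X → ℝ}
    (hg : Measurable g) {M : ℝ} (hM : ∀ x, |g x| ≤ M) {c : ℝ} (hc : ∀ x y, g x - g y ≤ c)
    (t : ℝ) :
    ∫ x, Real.exp (t * g x) ∂μ ≤ Real.exp (t * ∫ x, g x ∂μ + t ^ 2 * c ^ 2 / 8) := by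
  have : Nonempty X := nonempty_of_isProbabilityMeasure μ
  have hb : BddBelow (Set.range g) := ⟨-M, by rintro _ ⟨x, rfl⟩; exact neg_le_of_abs_le (hM x)⟩
  have hmem : ∀ x, g x ∈ Set.Icc (⨅ y, g y) ((⨅ y, g y) + c) := fun x =>
    ⟨ciInf_le hb x, by
      have : g x - c ≤ ⨅ y, g y := le_ciInf fun y => by linarith [hc x y]
      linarith⟩
  have h := (hasSubgaussianMGF_of_mem_Icc hg.aemeasurable
    (Filter.Eventually.of_forall hmem : ∀ᵐ x ∂μ, _)).mgf_le t
  simp only [mgf, add_sub_cancel_left, mul_sub, Real.exp_sub, integral_div] at h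
  rw [div_le_iff₀ (Real.exp_pos _), ← Real.exp_add] at h
  refine h.trans (Real.exp_le_exp.2 (le_of_eq ?_))
  push_cast
  rw [div_pow, Real.norm_eq_abs, sq_abs]
  ring

/-- The moment generating function of a function with bounded differences of independent
variables. -/
lemma integral_exp_mul_pi_fin_le {n : ℕ} (μ : Fin n → Measure X) [∀ i, IsProbabilityMeasure (μ i)]
    {f : (Fin n → X) → ℝ} (hf : Measurable f) {M : ℝ} (hM : ∀ x, |f x| ≤ M) {c : Fin n → ℝ}
    (hc : ∀ x i y, |f (update x i y) - f x| ≤ c i) (t : ℝ) :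
    ∫ x, Real.exp (t * f x) ∂(Measure.pi μ) ≤
      Real.exp (t * ∫ x, f x ∂(Measure.pi μ) + t ^ 2 * (∑ i, c i ^ 2) / 8) := by
  induction n with
  | zero =>
    have h : f = fun _ => f default := funext fun x => congrArg f (Subsingleton.elim _ _)
    rw [h]
    simp
  | succ n ih =>
    let e := (MeasurableEquiv.piFinSuccAbove (fun _ : Fin (n + 1) => X) 0).symm
    have he : MeasurePreserving e
        ((μ 0).prod (Measure.pi fun j : Fin n => μ j.succ)) (Measure.pi μ) :=
      (measurePreserving_piFinSuccAbove μ 0).symm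
    have hcons : ∀ p, e p = Fin.cons p.1 p.2 := fun p => by
      simp [e, MeasurableEquiv.piFinSuccAbove, Fin.insertNthEquiv]
    have hmeas : Measurable fun p => f (e p) := hf.comp e.measurable
    have hint : Integrable (fun p => f (e p)) ((μ 0).prod (Measure.pi fun j : Fin n => μ j.succ)) :=
      integrable_of_abs_le hmeas fun p => hM _
    have hexp : Integrable (fun p => Real.exp (t * f (e p)))
        ((μ 0).prod (Measure.pi fun j : Fin n => μ j.succ)) := by
      refine integrable_of_abs_le (M := Real.exp (|t| * M)) (by fun_prop) fun p => ?_
      rw [abs_of_pos (Real.exp_pos _), Real.exp_le_exp]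
      refine (le_abs_self _).trans ?_
      rw [abs_mul]
      exact mul_le_mul_of_nonneg_left (hM _) (abs_nonneg _)
    have hmeas' : ∀ a, Measurable fun b => f (e (a, b)) := fun a =>
      hmeas.comp measurable_prodMk_left
    set g : X → ℝ := fun a => ∫ b, f (e (a, b)) ∂(Measure.pi fun j : Fin n => μ j.succ) with hg
    have hgm : Measurable g := (hmeas.stronglyMeasurable.integral_prod_right').measurable
    have hgM : ∀ a, |g a| ≤ M := fun a => abs_integral_le_of_abs_le fun b => hM _
    have hgc : ∀ a a', g a - g a' ≤ c 0 := by
      intro a a'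
      rw [hg, ← integral_sub (integrable_of_abs_le (hmeas' a) fun b => hM _)
        (integrable_of_abs_le (hmeas' a') fun b => hM _)]
      refine (le_abs_self _).trans (abs_integral_le_of_abs_le fun b => ?_)
      have := hc (e (a', b)) 0 a
      rwa [hcons (a', b), Fin.update_cons_zero, ← hcons (a, b), ← hcons (a', b)] at this
    rw [← he.integral_comp' , ← he.integral_comp', integral_prod _ hint, integral_prod _ hexp]
    calc ∫ a, ∫ b, Real.exp (t * f (e (a, b))) ∂(Measure.pi fun j : Fin n => μ j.succ) ∂(μ 0)
        ≤ ∫ a, Real.exp (t * g a) * Real.exp (t ^ 2 * (∑ i : Fin n, c i.succ ^ 2) / 8) ∂(μ 0) := by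
          refine integral_mono_of_nonneg (Filter.Eventually.of_forall fun a =>
            integral_nonneg fun b => (Real.exp_pos _).le) ?_ (Filter.Eventually.of_forall fun a => ?_)
          · refine Integrable.mul_const (integrable_of_abs_le (M := Real.exp (|t| * M))
              (by fun_prop) fun a => ?_) _
            rw [abs_of_pos (Real.exp_pos _), Real.exp_le_exp]
            refine (le_abs_self _).trans ?_
            rw [abs_mul]
            exact mul_le_mul_of_nonneg_left (hgM _) (abs_nonneg _)
          · beta_reduce
            rw [← Real.exp_add]
            refine ih (fun j => μ j.succ) (hmeas' a) (fun b => hM _) fun b i y => ?_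
            have := hc (e (a, b)) i.succ y
            rwa [hcons (a, b), ← Fin.cons_update, ← hcons (a, update b i y), ← hcons (a, b)] at this
      _ ≤ Real.exp (t * ∫ a, g a ∂(μ 0) + t ^ 2 * c 0 ^ 2 / 8)
          * Real.exp (t ^ 2 * (∑ i : Fin n, c i.succ ^ 2) / 8) := by
          rw [integral_mul_const]
          exact mul_le_mul_of_nonneg_right (integral_exp_mul_le hgm hgM hgc t) (Real.exp_pos _).le
      _ = _ := by
          rw [← Real.exp_add, Fin.sum_univ_succ]
          congr 1
          ring

variable {ι : Type*} [Fintype ι] [DecidableEq ι]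

lemma integral_exp_mul_pi_le (μ : ι → Measure X) [∀ i, IsProbabilityMeasure (μ i)]
    {f : (ι → X) → ℝ} (hf : Measurable f) {M : ℝ} (hM : ∀ x, |f x| ≤ M) {c : ι → ℝ}
    (hc : ∀ x i y, |f (update x i y) - f x| ≤ c i) (t : ℝ) :
    ∫ x, Real.exp (t * f x) ∂(Measure.pi μ) ≤
      Real.exp (t * ∫ x, f x ∂(Measure.pi μ) + t ^ 2 * (∑ i, c i ^ 2) / 8) := by
  let e := (Fintype.equivFin ι).symm
  let E := MeasurableEquiv.piCongrLeft (fun _ : ι => X) e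
  have hE : MeasurePreserving E (Measure.pi fun i => μ (e i)) (Measure.pi μ) :=
    measurePreserving_piCongrLeft μ e
  have hup : ∀ x i y, E (update x i y) = update (E x) (e i) y := by
    intro x i y
    ext j
    obtain ⟨j, rfl⟩ := e.surjective j
    have h := fun x' => Equiv.piCongrLeft_apply_apply (fun _ : ι => X) e x' j
    by_cases hij : j = i
    · subst hij
      rw [update_self]
      exact (h _).trans (update_self ..)
    · rw [update_of_ne (fun h' => hij (e.injective h'))]
      exact (h _).trans ((update_of_ne hij ..).trans (h _).symm)
  rw [← hE.integral_comp', ← hE.integral_comp', ← e.sum_comp]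
  exact integral_exp_mul_pi_fin_le _ (hf.comp E.measurable) (fun x => hM _)
    (fun x i y => by rw [comp_apply, comp_apply, hup]; exact hc _ _ _) t

/-- **McDiarmid's inequality**. -/
theorem measureReal_pi_ge_le (μ : ι → Measure X) [∀ i, IsProbabilityMeasure (μ i)]
    {f : (ι → X) → ℝ} (hf : Measurable f) {M : ℝ} (hM : ∀ x, |f x| ≤ M) {c : ι → ℝ}
    (hc : ∀ x i y, |f (update x i y) - f x| ≤ c i) {r : ℝ} (hr : 0 ≤ r) :
    (Measure.pi μ).real {x | r ≤ f x - ∫ y, f y ∂(Measure.pi μ)} ≤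
      Real.exp (-(2 * r ^ 2) / ∑ i, c i ^ 2) := by
  have hnn : 0 ≤ (∑ i, c i ^ 2) / 4 := by positivity
  have h : HasSubgaussianMGF (fun x => f x - ∫ y, f y ∂(Measure.pi μ))
      ((∑ i, c i ^ 2) / 4).toNNReal (Measure.pi μ) := by
    refine ⟨fun t => ?_, fun t => ?_⟩
    · refine integrable_of_abs_le (M := Real.exp (|t| * (M + M))) (by fun_prop) fun x => ?_
      rw [abs_of_pos (Real.exp_pos _), Real.exp_le_exp]
      refine (le_abs_self _).trans ?_
      rw [abs_mul]
      exact mul_le_mul_of_nonneg_left ((abs_sub _ _).trans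
        (add_le_add (hM x) (abs_integral_le_of_abs_le hM))) (abs_nonneg _)
    · simp only [mgf, mul_sub, Real.exp_sub, integral_div, Real.coe_toNNReal _ hnn]
      rw [div_le_iff₀ (Real.exp_pos _), ← Real.exp_add]
      refine (integral_exp_mul_pi_le μ hf hM hc t).trans (Real.exp_le_exp.2 (le_of_eq ?_))
      ring
  refine (h.measure_ge_le hr).trans (Real.exp_le_exp.2 (le_of_eq ?_))
  rw [Real.coe_toNNReal _ hnn, show 2 * ((∑ i, c i ^ 2) / 4) = (∑ i, c i ^ 2) / 2 by ring,
    div_div_eq_mul_div]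
  ring

end McDiarmid

/-! ### Uniform deviations of sums of independent terms -/

section UniformDeviation

variable {X T ι : Type*} [Fintype ι]

/-- The largest difference, over the class `T`, of the sums at two samples, which are given as one
sample of pairs. -/
noncomputable def maxDiff (φ : ι → T → X → ℝ) (z : ι → X × X) : ℝ :=
  ⨆ t, |∑ s, (φ s t (z s).1 - φ s t (z s).2)|

variable {φ : ι → T → X → ℝ} {M : ι → ℝ}

lemma abs_sum_sub_le (hM : ∀ s t x, |φ s t x| ≤ M s) (t : T) (z : ι → X × X) :
    |∑ s, (φ s t (z s).1 - φ s t (z s).2)| ≤ ∑ s, (M s + M s) :=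
  (abs_sum_le_sum_abs _ _).trans (sum_le_sum fun s _ =>
    (abs_sub _ _).trans (add_le_add (hM s t _) (hM s t _)))

lemma abs_sum_sub_le_maxDiff (hM : ∀ s t x, |φ s t x| ≤ M s) (t : T) (z : ι → X × X) :
    |∑ s, (φ s t (z s).1 - φ s t (z s).2)| ≤ maxDiff φ z :=
  le_ciSup (f := fun t => |∑ s, (φ s t (z s).1 - φ s t (z s).2)|)
    ⟨_, by rintro _ ⟨t, rfl⟩; exact abs_sum_sub_le hM t z⟩ t

lemma maxDiff_nonneg (φ : ι → T → X → ℝ) (z : ι → X × X) : 0 ≤ maxDiff φ z :=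
  Real.iSup_nonneg fun _ => abs_nonneg _

lemma abs_maxDiff_le [Nonempty T] (hM : ∀ s t x, |φ s t x| ≤ M s) (z : ι → X × X) :
    |maxDiff φ z| ≤ ∑ s, (M s + M s) := by
  rw [abs_of_nonneg (maxDiff_nonneg φ z)]
  exact ciSup_le fun t => abs_sum_sub_le hM t z

lemma maxDiff_update_le [DecidableEq ι] [Nonempty T] (hM : ∀ s t x, |φ s t x| ≤ M s)
    (x x' : ι → X) (i : ι) (y : X) :
    maxDiff φ (fun s => (update x i y s, x' s)) ≤ maxDiff φ (fun s => (x s, x' s)) + 2 * M i := by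
  refine ciSup_le fun t => ?_
  have h : ∑ s, (φ s t (update x i y s) - φ s t (x' s)) =
      ∑ s, (φ s t (x s) - φ s t (x' s)) + (φ i t y - φ i t (x i)) := by
    rw [← sum_erase_add _ _ (mem_univ i),
      ← sum_erase_add univ (fun s => φ s t (x s) - φ s t (x' s)) (mem_univ i), update_self,
      sum_congr rfl fun s hs => by rw [update_of_ne (ne_of_mem_erase hs)]]
    ring
  rw [h]
  refine (abs_add_le _ _).trans (add_le_add
    (abs_sum_sub_le_maxDiff hM t (fun s => (x s, x' s))) ?_)
  refine (abs_sub _ _).trans ?_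
  linarith [hM i t y, hM i t (x i)]

lemma abs_maxDiff_update_sub_le [DecidableEq ι] [Nonempty T] (hM : ∀ s t x, |φ s t x| ≤ M s)
    (x x' : ι → X) (i : ι) (y : X) :
    |maxDiff φ (fun s => (update x i y s, x' s)) - maxDiff φ (fun s => (x s, x' s))| ≤
      2 * M i := by
  have h1 := maxDiff_update_le hM x x' i y
  have h2 := maxDiff_update_le hM (update x i y) x' i (x i)
  rw [update_idem, update_eq_self] at h2
  rw [abs_le]
  constructor <;> linarith

/-- Exchange of the two points of those pairs whose sign is `-1`. -/
def signedSwap (ε : ι → ℤˣ) (z : ι → X × X) : ι → X × X :=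
  fun s => if ε s = 1 then z s else (z s).swap

lemma maxDiff_signedSwap (ε : ι → ℤˣ) (z : ι → X × X) :
    maxDiff φ (signedSwap ε z) = ⨆ t, |∑ s, sgn (ε s) * (φ s t (z s).1 - φ s t (z s).2)| := by
  unfold maxDiff
  congr 1
  ext t
  congr 1
  refine sum_congr rfl fun s _ => ?_
  rcases Int.units_eq_one_or (ε s) with h | h
  · simp [signedSwap, h]
  · have h' : ¬ ((-1 : ℤˣ) = 1) := by decide
    simp [signedSwap, h, h']

/-- Random exchanges of the two samples turn the difference of the sums into Rademacher sums. The
bound is uniform in the samples. -/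
lemma expect_maxDiff_signedSwap_le [DecidableEq ι] [Nonempty T] {d : ι → ℝ}
    {t₀ : T} (h₀ : ∀ s x, φ s t₀ x = d s) {D : ℝ}
    (hD : ∀ x : ι → X, RadLE (fun s t => φ s t (x s) - d s) D) (z : ι → X × X) :
    𝔼 ε : ι → ℤˣ, maxDiff φ (signedSwap ε z) ≤ 4 * D := by
  refine le_of_forall_pos_le_add fun η hη => ?_
  have hex : ∀ ε : ι → ℤˣ, ∃ t, maxDiff φ (signedSwap ε z) ≤
      |∑ s, sgn (ε s) * (φ s t (z s).1 - φ s t (z s).2)| + η := by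
    intro ε
    rw [maxDiff_signedSwap]
    obtain ⟨t, ht⟩ := exists_lt_of_lt_ciSup (sub_lt_self
      (⨆ t, |∑ s, sgn (ε s) * (φ s t (z s).1 - φ s t (z s).2)|) hη)
    exact ⟨t, by linarith⟩
  choose t ht using hex
  have h1 := (hD fun s => (z s).1).expect_abs_le (t₀ := t₀) (by simp [h₀]) t
  have h2 := (hD fun s => (z s).2).expect_abs_le (t₀ := t₀) (by simp [h₀]) t
  calc 𝔼 ε : ι → ℤˣ, maxDiff φ (signedSwap ε z)
      ≤ 𝔼 ε : ι → ℤˣ, (|∑ s, sgn (ε s) * (φ s (t ε) (z s).1 - d s)| +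
          |∑ s, sgn (ε s) * (φ s (t ε) (z s).2 - d s)| + η) := by
        refine expect_le_expect fun ε _ => (ht ε).trans (add_le_add_left ?_ _)
        refine le_of_eq_of_le ?_ (abs_sub _ _)
        rw [← sum_sub_distrib]
        congr 1
        exact sum_congr rfl fun s _ => by ring
    _ ≤ 4 * D + η := by
        rw [expect_add_distrib, expect_add_distrib, Fintype.expect_const]
        linarith

variable [MeasurableSpace X]

lemma measurePreserving_signedSwap (μ : ι → Measure X) [∀ s, IsProbabilityMeasure (μ s)]
    (ε : ι → ℤˣ) :
    MeasurePreserving (signedSwap (X := X) ε) (Measure.pi fun s => (μ s).prod (μ s))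
      (Measure.pi fun s => (μ s).prod (μ s)) := by
  refine measurePreserving_pi (f := fun s (p : X × X) => if ε s = 1 then p else p.swap) _ _
    fun s => ?_
  by_cases h : ε s = 1
  · simp only [h, if_true]
    exact MeasurePreserving.id _
  · simpa [h] using Measure.measurePreserving_swap

/-- **Symmetrization**: the expected largest difference between two independent samples is bounded
by Rademacher averages. -/
lemma integral_maxDiff_le [DecidableEq ι] [Nonempty T] (μ : ι → Measure X)
    [∀ s, IsProbabilityMeasure (μ s)]
    (hM : ∀ s t x, |φ s t x| ≤ M s) (hmeas : Measurable (maxDiff φ)) {d : ι → ℝ}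
    {t₀ : T} (h₀ : ∀ s x, φ s t₀ x = d s) {D : ℝ}
    (hD : ∀ x : ι → X, RadLE (fun s t => φ s t (x s) - d s) D) :
    ∫ z, maxDiff φ z ∂(Measure.pi fun s => (μ s).prod (μ s)) ≤ 4 * D := by
  set ν := Measure.pi fun s => (μ s).prod (μ s)
  have hsw : ∀ ε : ι → ℤˣ, ∫ z, maxDiff φ (signedSwap ε z) ∂ν = ∫ z, maxDiff φ z ∂ν := by
    intro ε
    have h := measurePreserving_signedSwap μ ε
    rw [← integral_map h.measurable.aemeasurable hmeas.aestronglyMeasurable, h.map_eq]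
  have hint : ∀ ε : ι → ℤˣ, Integrable (fun z => maxDiff φ (signedSwap ε z)) ν := fun ε =>
    integrable_of_abs_le (hmeas.comp (measurePreserving_signedSwap μ ε).measurable)
      fun z => abs_maxDiff_le hM _
  calc ∫ z, maxDiff φ z ∂ν = 𝔼 ε : ι → ℤˣ, ∫ z, maxDiff φ (signedSwap ε z) ∂ν := by
        simp [hsw]
    _ = ∫ z, 𝔼 ε : ι → ℤˣ, maxDiff φ (signedSwap ε z) ∂ν := by
        simp only [Fintype.expect_eq_sum_div_card, integral_div]
        rw [integral_finsetSum _ fun ε _ => hint ε]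
    _ ≤ ∫ _z, 4 * D ∂ν := by
        refine integral_mono_of_nonneg (Filter.Eventually.of_forall fun z =>
          expect_nonneg fun ε _ => maxDiff_nonneg φ _) (integrable_const _)
          (Filter.Eventually.of_forall fun z => expect_maxDiff_signedSwap_le h₀ hD z)
    _ = 4 * D := by simp

/-- The largest difference to an independent second sample, averaged over the second sample.
It bounds the uniform deviation and, unlike that, it is measurable as soon as `maxDiff φ` is. -/
noncomputable def meanMaxDiff (φ : ι → T → X → ℝ) (μ : ι → Measure X) (x : ι → X) : ℝ :=
  ∫ x', maxDiff φ (fun s => (x s, x' s)) ∂(Measure.pi μ)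

section

variable (μ : ι → Measure X) [∀ s, IsProbabilityMeasure (μ s)]

lemma measurable_pair_right {ι : Type*} (x : ι → X) :
    Measurable fun (x' : ι → X) s => (x s, x' s) :=
  measurable_pi_lambda _ fun s => measurable_const.prodMk (measurable_pi_apply s)

lemma stronglyMeasurable_maxDiff_symm (hmeas : Measurable (maxDiff φ)) :
    StronglyMeasurable fun p : (ι → X) × (ι → X) => maxDiff φ (fun s => (p.1 s, p.2 s)) :=
  (hmeas.comp (measurable_pi_lambda _ fun s =>
    ((measurable_pi_apply s).comp measurable_fst).prodMk
      ((measurable_pi_apply s).comp measurable_snd))).stronglyMeasurable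

lemma measurable_meanMaxDiff (hmeas : Measurable (maxDiff φ)) : Measurable (meanMaxDiff φ μ) :=
  (stronglyMeasurable_maxDiff_symm hmeas).integral_prod_right'.measurable

lemma integral_meanMaxDiff [Nonempty T] (hM : ∀ s t x, |φ s t x| ≤ M s)
    (hmeas : Measurable (maxDiff φ)) :
    ∫ x, meanMaxDiff φ μ x ∂(Measure.pi μ) =
      ∫ z, maxDiff φ z ∂(Measure.pi fun s => (μ s).prod (μ s)) := by
  have h := (measurePreserving_arrowProdEquivProdArrow X X ι μ μ).symm
  rw [← h.integral_comp', integral_prod]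
  · rfl
  · exact integrable_of_abs_le (stronglyMeasurable_maxDiff_symm hmeas).measurable
      fun p => abs_maxDiff_le hM _

lemma abs_meanMaxDiff_update_sub_le [DecidableEq ι] [Nonempty T] (hM : ∀ s t x, |φ s t x| ≤ M s)
    (hmeas : Measurable (maxDiff φ)) (x : ι → X) (i : ι) (y : X) :
    |meanMaxDiff φ μ (update x i y) - meanMaxDiff φ μ x| ≤ 2 * M i := by
  have hint : ∀ x : ι → X, Integrable (fun x' : ι → X => maxDiff φ (fun s => (x s, x' s)))
      (Measure.pi μ) := fun x =>
    integrable_of_abs_le (hmeas.comp (measurable_pair_right x)) fun x' => abs_maxDiff_le hM _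
  unfold meanMaxDiff
  rw [← integral_sub (hint _) (hint _)]
  exact abs_integral_le_of_abs_le fun x' => abs_maxDiff_update_sub_le hM x x' i y

lemma abs_sum_sub_integral_le [Nonempty T] (hM : ∀ s t x, |φ s t x| ≤ M s)
    (hφ : ∀ s t, Measurable (φ s t)) (hmeas : Measurable (maxDiff φ)) (x : ι → X) (t : T) :
    |∑ s, φ s t (x s) - ∑ s, ∫ y, φ s t y ∂(μ s)| ≤ meanMaxDiff φ μ x := by
  have hev : ∀ s, Integrable (fun x' : ι → X => φ s t (x' s)) (Measure.pi μ) := fun s =>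
    integrable_of_abs_le ((hφ s t).comp (measurable_pi_apply s)) fun x' => hM s t _
  have h1 : ∑ s, φ s t (x s) - ∑ s, ∫ y, φ s t y ∂(μ s) =
      ∫ x' : ι → X, ∑ s, (φ s t (x s) - φ s t (x' s)) ∂(Measure.pi μ) := by
    rw [integral_finsetSum _ fun s _ => Integrable.sub' (integrable_const _) (hev s),
      ← sum_sub_distrib]
    refine sum_congr rfl fun s _ => ?_
    rw [integral_sub (integrable_const _) (hev s), integral_const]
    have := (measurePreserving_eval μ s).map_eq
    conv_lhs => rw [← this]
    rw [integral_map (measurable_pi_apply s).aemeasurable (hφ s t).aestronglyMeasurable]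
    simp
  rw [h1]
  refine (abs_integral_le_integral_abs).trans (integral_mono ?_ ?_ fun x' =>
    abs_sum_sub_le_maxDiff hM t fun s => (x s, x' s))
  · exact (integrable_finsetSum _ fun s _ => (integrable_const _).sub (hev s)).abs
  · exact integrable_of_abs_le (hmeas.comp (measurable_pair_right x)) fun x' => abs_maxDiff_le hM _

end

/-- The uniform deviation bound: bounded differences give the concentration, and
symmetrization bounds the mean. The class need not be countable. -/
theorem exists_event_uniform_deviation_le [DecidableEq ι] (μ : ι → Measure X)
    [∀ s, IsProbabilityMeasure (μ s)]
    (hM : ∀ s t x, |φ s t x| ≤ M s) (hφ : ∀ s t, Measurable (φ s t))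
    (hmeas : Measurable (maxDiff φ)) {d : ι → ℝ} {t₀ : T} (h₀ : ∀ s x, φ s t₀ x = d s) {D : ℝ}
    (hD : ∀ x : ι → X, RadLE (fun s t => φ s t (x s) - d s) D)
    {Ω : Type*} [MeasurableSpace Ω] (Pr : Measure Ω) [IsProbabilityMeasure Pr]
    {S : Ω → ι → X} (hS : Measurable S) (hlaw : Pr.map S = Measure.pi μ)
    {δ : ℝ} (hδ : 0 < δ) (hδ1 : δ ≤ 1) :
    ∃ E : Set Ω, MeasurableSet E ∧ ENNReal.ofReal (1 - δ) ≤ Pr E ∧ ∀ ω ∈ E, ∀ t,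
      |∑ s, φ s t (S ω s) - ∑ s, ∫ y, φ s t y ∂(μ s)| ≤
        √(2 * Real.log (2 / δ)) * √(∑ s, M s ^ 2) + 4 * D := by
  have : Nonempty T := ⟨t₀⟩
  obtain ⟨ω₀⟩ := nonempty_of_isProbabilityMeasure Pr
  have hlog : 0 < Real.log (2 / δ) := Real.log_pos (by rw [lt_div_iff₀ hδ]; linarith)
  set r := √(2 * Real.log (2 / δ)) * √(∑ s, M s ^ 2) with hr
  have hr0 : 0 ≤ r := by positivity
  have hsum : 0 ≤ ∑ s, M s ^ 2 := sum_nonneg fun s _ => sq_nonneg _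
  have hm := measurable_meanMaxDiff μ hmeas
  have hmean : ∫ x, meanMaxDiff φ μ x ∂(Measure.pi μ) ≤ 4 * D :=
    (integral_meanMaxDiff μ hM hmeas).trans_le (integral_maxDiff_le μ hM hmeas h₀ hD)
  rcases hsum.eq_or_lt with h0 | hpos
  · -- All terms vanish, and the event is the whole space.
    have hM0 : ∀ s, M s = 0 := fun s => by
      have := (sum_eq_zero_iff_of_nonneg fun s _ => sq_nonneg (M s)).1 h0.symm s (mem_univ s)
      simpa using this
    have hφ0 : ∀ s t x, φ s t x = 0 := fun s t x => by
      have := hM s t x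
      rw [hM0] at this
      exact abs_nonpos_iff.1 this
    refine ⟨Set.univ, MeasurableSet.univ, ?_, fun ω _ t => ?_⟩
    · rw [measure_univ, ENNReal.ofReal_le_one]
      linarith
    · have hmean0 : 0 ≤ ∫ x, meanMaxDiff φ μ x ∂(Measure.pi μ) :=
        integral_nonneg fun x => integral_nonneg fun x' => maxDiff_nonneg φ _
      simp only [hφ0, sum_const_zero, integral_zero, sub_zero, abs_zero]
      linarith
  · set B : Set (ι → X) := {x | r ≤ meanMaxDiff φ μ x - ∫ y, meanMaxDiff φ μ y ∂(Measure.pi μ)}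
    have hB : MeasurableSet B := measurableSet_le measurable_const (hm.sub_const _)
    have htail : (Measure.pi μ).real B ≤ δ := by
      refine (measureReal_pi_ge_le μ hm (M := ∑ s, (M s + M s)) (fun x =>
        abs_integral_le_of_abs_le fun x' => abs_maxDiff_le hM _)
        (abs_meanMaxDiff_update_sub_le μ hM hmeas) hr0).trans ?_
      have : -(2 * r ^ 2) / ∑ s, (2 * M s) ^ 2 = -Real.log (2 / δ) := by
        rw [hr, mul_pow, Real.sq_sqrt (by positivity), Real.sq_sqrt hsum]
        simp only [mul_pow, ← mul_sum]
        field_simp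
      rw [this, Real.exp_neg, Real.exp_log (by positivity), inv_div]
      linarith
    refine ⟨S ⁻¹' Bᶜ, hS hB.compl, ?_, fun ω hω t => ?_⟩
    · rw [← Measure.map_apply hS hB.compl, hlaw, ← ofReal_measureReal, measureReal_compl hB]
      refine ENNReal.ofReal_le_ofReal ?_
      simp only [probReal_univ]
      linarith
    · have h1 := abs_sum_sub_integral_le μ hM hφ hmeas (S ω) t
      have h2 : meanMaxDiff φ μ (S ω) - ∫ y, meanMaxDiff φ μ y ∂(Measure.pi μ) < r := by
        simpa [B] using hω
      linarith

end UniformDeviation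

/-! ### Lipschitz constants of composite losses -/

section LipConst

variable {C : ℕ} {V : Set (EuclideanSpace ℝ (Fin C))} {r : EuclideanSpace ℝ (Fin C) → Fin C → ℝ}

lemma lipConst_nonneg : 0 ≤ lipConst V r := Real.sInf_nonneg fun _ h => h.1

/-- The infimum in the definition of `lipConst` is attained. -/
lemma isLipConst_lipConst (h : ∃ L, IsLipConst V r L) : IsLipConst V r (lipConst V r) := by
  refine ⟨lipConst_nonneg, fun c a ha b hb => ?_⟩
  rcases (norm_nonneg (a - b)).eq_or_lt with h0 | h0
  · have : a = b := sub_eq_zero.1 (norm_eq_zero.1 h0.symm)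
    simp [this]
  · rw [← div_le_iff₀ h0]
    exact le_csInf h fun L hL => (div_le_iff₀ h0).2 (hL.2 c a ha b hb)

lemma abs_le_absAtZero (r : EuclideanSpace ℝ (Fin C) → Fin C → ℝ) (c : Fin C) :
    |r 0 c| ≤ absAtZero r :=
  le_ciSup (f := fun c => |r 0 c|) (Set.finite_range _).bddAbove c

end LipConst

/-! ### The noisy distributions -/

section Noisy

variable {X : Type*} [MeasurableSpace X] {C : ℕ}

lemma measurableSet_label (c : Fin C) : MeasurableSet (Prod.snd ⁻¹' {c} : Set (X × Fin C)) :=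
  measurable_snd (measurableSet_singleton c)

lemma isProbabilityMeasure_noisy (P : Measure (X × Fin C)) [IsProbabilityMeasure P]
    {T : Matrix (Fin C) (Fin C) ℝ} (hT : T ∈ Matrix.colStochastic ℝ (Fin C)) :
    IsProbabilityMeasure (noisy P T) := by
  have hj : jointNoisy P T Set.univ = 1 := by
    unfold jointNoisy
    simp only [Measure.coe_finsetSum, Finset.sum_apply, Measure.smul_apply, smul_eq_mul]
    have h1 : ∀ i j : Fin C, (P.restrict (Prod.snd ⁻¹' {i})).map (fun z => (z.1, z.2, j))
        Set.univ = P (Prod.snd ⁻¹' {i}) := fun i j => by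
      rw [Measure.map_apply (by fun_prop) MeasurableSet.univ]
      simp
    have h2 : ∀ i : Fin C, ∑ j, ENNReal.ofReal (T j i) = 1 := fun i => by
      rw [← ENNReal.ofReal_sum_of_nonneg fun j _ => hT.1 j i]
      have := (Matrix.mem_colStochastic_iff_sum.1 hT).2 i
      simp [this]
    simp only [h1, ← Finset.sum_mul, h2, one_mul]
    have h3 : P Set.univ = ∑ i : Fin C, P (Prod.snd ⁻¹' {i}) := by
      rw [← measure_biUnion_finset (fun i _ j _ hij => ?_) fun i _ => measurableSet_label i]
      · congr 1
        ext z
        simp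
      · exact Set.disjoint_left.2 fun z hz hz' => hij (hz.symm.trans hz')
    rw [← h3, measure_univ]
  refine ⟨?_⟩
  rw [noisy, Measure.map_apply (by fun_prop) MeasurableSet.univ, Set.preimage_univ, hj]

lemma isProbabilityMeasure_classCond (P : Measure (X × Fin C))
    {T : Matrix (Fin C) (Fin C) ℝ} [IsProbabilityMeasure (noisy P T)] {c : Fin C}
    (hc : 0 < noisyPrior P T c) : IsProbabilityMeasure (classCond P T c) := by
  have h : noisy P T (Prod.snd ⁻¹' {c}) ≠ 0 := fun h0 => by
    simp [noisyPrior, measureReal_def, h0] at hc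
  have := cond_isProbabilityMeasure h
  exact Measure.isProbabilityMeasure_map measurable_fst.aemeasurable

lemma noisyPrior_mul_integral_classCond (P : Measure (X × Fin C)) {T : Matrix (Fin C) (Fin C) ℝ}
    {c : Fin C} (hc : 0 < noisyPrior P T c) {h : X → ℝ} (hh : Measurable h) :
    noisyPrior P T c * ∫ x, h x ∂(classCond P T c) =
      ∫ z in Prod.snd ⁻¹' {c}, h z.1 ∂(noisy P T) := by
  rw [classCond, integral_map measurable_fst.aemeasurable hh.aestronglyMeasurable,
    ProbabilityTheory.cond,
    integral_smul_measure, ENNReal.toReal_inv, smul_eq_mul, ← measureReal_def]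
  exact mul_inv_cancel_left₀ hc.ne' _

/-- A risk is the mean of the class conditional risks, weighted by the priors. -/
lemma sum_noisyPrior_mul_integral_classCond (P : Measure (X × Fin C))
    {T : Matrix (Fin C) (Fin C) ℝ} [IsProbabilityMeasure (noisy P T)]
    (hc : ∀ c, 0 < noisyPrior P T c) {h : Fin C → X → ℝ} (hh : ∀ c, Measurable (h c)) {M : ℝ}
    (hM : ∀ c x, |h c x| ≤ M) :
    ∑ c, noisyPrior P T c * ∫ x, h c x ∂(classCond P T c) = ∫ z, h z.2 z.1 ∂(noisy P T) := by
  have hm : ∀ c, Measurable fun z : X × Fin C => h c z.1 := fun c => (hh c).comp measurable_fst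
  simp only [noisyPrior_mul_integral_classCond P (hc _) (hh _),
    ← integral_indicator (measurableSet_label _)]
  rw [← integral_finsetSum _ fun c _ => Integrable.indicator
    (integrable_of_abs_le (hm c) fun z => hM c z.1) (measurableSet_label c)]
  congr 1
  ext z
  rw [Finset.sum_eq_single z.2]
  · simp
  · intro c _ hcz
    exact Set.indicator_of_notMem (fun hz => hcz hz.symm) _
  · simp

end Noisy

/-! ### Reduction of the bound to Rademacher averages -/

namespace Setting

section

variable {X : Type*} [MeasurableSpace X] {C N : ℕ} (M : Setting X C N)

lemma isLipConst_lam (i : Fin N) : IsLipConst M.V (M.lam i) (lipConst M.V (M.lam i)) := by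
  choose L hL using M.lipschitz i
  refine isLipConst_lipConst ⟨∑ c, |L c|, sum_nonneg fun c _ => abs_nonneg _, fun c a ha b hb => ?_⟩
  refine (hL c a ha b hb).trans (mul_le_mul_of_nonneg_right ?_ (norm_nonneg _))
  exact (le_abs_self _).trans (single_le_sum (f := fun c => |L c|) (fun c _ => abs_nonneg _)
    (mem_univ c))

/-- On `V` the composite losses agree with functions that are continuous on the whole space. -/
lemma exists_continuous_eq_lam (i : Fin N) (c : Fin C) :
    ∃ Λ : EuclideanSpace ℝ (Fin C) → ℝ, Continuous Λ ∧ ∀ v ∈ M.V, M.lam i v c = Λ v := by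
  have h := M.isLipConst_lam i
  have hl : LipschitzOnWith (Real.toNNReal (lipConst M.V (M.lam i))) (fun v => M.lam i v c) M.V :=
    LipschitzOnWith.of_dist_le_mul fun a ha b hb => by
      rw [Real.coe_toNNReal _ h.1, Real.dist_eq, dist_eq_norm]
      exact h.2 c a ha b hb
  obtain ⟨Λ, hΛ, heq⟩ := hl.extend_real
  exact ⟨Λ, hΛ.continuous, heq⟩

lemma abs_lam_le (h0 : (0 : EuclideanSpace ℝ (Fin C)) ∈ M.V) {A : ℝ} (i : Fin N) (c : Fin C)
    {v : EuclideanSpace ℝ (Fin C)} (hv : v ∈ M.V) (hA : ‖v‖ ≤ A) :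
    |M.lam i v c| ≤ ⨆ i, (lipConst M.V (M.lam i) * A + absAtZero (M.lam i)) := by
  refine le_trans ?_ (le_ciSup (f := fun i => lipConst M.V (M.lam i) * A + absAtZero (M.lam i))
    (Set.finite_range _).bddAbove i)
  have h1 := (M.isLipConst_lam i).2 c v hv 0 h0
  rw [sub_zero] at h1
  have h2 := abs_le_absAtZero (M.lam i) c
  have h3 := mul_le_mul_of_nonneg_left hA (lipConst_nonneg (V := M.V) (r := M.lam i))
  have h4 := abs_sub_abs_le_abs_sub (M.lam i v c) (M.lam i 0 c)
  linarith

/-- The weight `w_i α_i(c) / n_{i,c}` of a data point in the empirical risk. -/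
noncomputable def weight (s : M.Index) : ℝ :=
  M.w s.1 * (M.α s.1 s.2.1 / (M.n s.1 s.2.1 : ℝ))

lemma weight_nonneg (s : M.Index) : 0 ≤ M.weight s :=
  mul_nonneg (M.w_mem.1 _) (div_nonneg measureReal_nonneg (Nat.cast_nonneg _))

/-- The law of a data point. -/
noncomputable def law (s : M.Index) : Measure X := classCond M.P (M.T s.1) s.2.1

lemma isProbabilityMeasure_noisy (i : Fin N) : IsProbabilityMeasure (noisy M.P (M.T i)) :=
  have := M.isProb
  LMNTM.isProbabilityMeasure_noisy M.P (M.stochastic i)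

instance isProbabilityMeasure_law (s : M.Index) : IsProbabilityMeasure (M.law s) :=
  have := M.isProbabilityMeasure_noisy s.1
  isProbabilityMeasure_classCond M.P (M.prior_pos _ _)

lemma sum_weight_sq_le : ∑ s, M.weight s ^ 2 ≤ ∑ i, ∑ c, M.w i ^ 2 / (M.n i c : ℝ) := by
  simp only [Fintype.sum_sigma, weight, sum_const, card_univ, Fintype.card_fin, nsmul_eq_mul]
  refine sum_le_sum fun i _ => sum_le_sum fun c _ => ?_
  have hn : (0 : ℝ) < M.n i c := by exact_mod_cast M.n_pos i c
  have := M.isProbabilityMeasure_noisy i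
  have h1 : M.α i c ≤ 1 := measureReal_le_one
  have h0 : 0 ≤ M.α i c := measureReal_nonneg
  have : (M.n i c : ℝ) * (M.w i * (M.α i c / M.n i c)) ^ 2 = M.w i ^ 2 / M.n i c * M.α i c ^ 2 := by
    field_simp
  rw [this]
  exact mul_le_of_le_one_right (by positivity) (pow_le_one₀ h0 h1)

lemma empRisk_eq_sum (S : M.Index → X) (g : X → EuclideanSpace ℝ (Fin C)) :
    M.empRisk S g = ∑ s, M.weight s * M.lam s.1 (g (S s)) s.2.1 := by
  simp only [empRisk, empRiskF, Fintype.sum_sigma, weight, ← mul_sum, mul_assoc]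
  rfl

variable {M}

lemma measurable_lam_comp {g : X → EuclideanSpace ℝ (Fin C)} (hg : Measurable g)
    (hV : ∀ x, g x ∈ M.V) (i : Fin N) (c : Fin C) : Measurable fun x => M.lam i (g x) c := by
  obtain ⟨Λ, hΛ, heq⟩ := M.exists_continuous_eq_lam i c
  simp only [heq _ (hV _)]
  exact hΛ.measurable.comp hg

lemma aggRisk_eq_sum {g : X → EuclideanSpace ℝ (Fin C)} (hg : Measurable g)
    (hV : ∀ x, g x ∈ M.V) {B : ℝ} (hB : ∀ i c x, |M.lam i (g x) c| ≤ B) :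
    M.aggRisk g = ∑ s, ∫ x, M.weight s * M.lam s.1 (g x) s.2.1 ∂(M.law s) := by
  simp only [Fintype.sum_sigma, integral_const_mul, weight, law, sum_const, card_univ,
    Fintype.card_fin, nsmul_eq_mul, aggRisk, aggRiskF]
  refine sum_congr rfl fun i _ => ?_
  have := M.isProbabilityMeasure_noisy i
  have h := sum_noisyPrior_mul_integral_classCond M.P (M.prior_pos i)
    (fun c => measurable_lam_comp hg hV i c) (fun c x => hB i c x)
  change M.w i * ∫ z, M.lam i (g z.1) z.2 ∂(noisy M.P (M.T i)) = _
  rw [← h, mul_sum]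
  refine sum_congr rfl fun c _ => ?_
  have hn : (M.n i c : ℝ) ≠ 0 := by exact_mod_cast (M.n_pos i c).ne'
  change M.w i * (M.α i c * _) = _
  field_simp

variable {Ω : Type*} [MeasurableSpace Ω] {Pr : Measure Ω} [IsProbabilityMeasure Pr]
  {S : M.Index → Ω → X}

/-- The empirical risk is an unbiased estimator of the aggregate risk. -/
lemma integral_empRisk (hS : M.IsSample Pr S) {g : X → EuclideanSpace ℝ (Fin C)}
    (hg : Measurable g) (hV : ∀ x, g x ∈ M.V) {B : ℝ} (hB : ∀ i c x, |M.lam i (g x) c| ≤ B) :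
    Integrable (fun ω => M.empRisk (fun s => S s ω) g) Pr ∧
      ∫ ω, M.empRisk (fun s => S s ω) g ∂Pr = M.aggRisk g := by
  have hm : ∀ s : M.Index, Measurable fun x => M.weight s * M.lam s.1 (g x) s.2.1 := fun s =>
    (measurable_lam_comp hg hV s.1 s.2.1).const_mul _
  have hint : ∀ s, Integrable (fun ω => M.weight s * M.lam s.1 (g (S s ω)) s.2.1) Pr := fun s =>
    integrable_of_abs_le (M := M.weight s * B) ((hm s).comp (hS.measurable s)) fun ω => by
      rw [abs_mul, abs_of_nonneg (M.weight_nonneg s)]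
      exact mul_le_mul_of_nonneg_left (hB _ _ _) (M.weight_nonneg s)
  simp only [empRisk_eq_sum, aggRisk_eq_sum hg hV hB]
  refine ⟨integrable_finsetSum _ fun s _ => hint s, ?_⟩
  rw [integral_finsetSum _ fun s _ => hint s]
  refine sum_congr rfl fun s _ => ?_
  have hl : Pr.map (S s) = M.law s := hS.law s
  rw [← hl, integral_map (hS.measurable s).aemeasurable (hm s).aestronglyMeasurable]

end

end Setting

/-- Suprema over the class of continuous functions of the values at finitely many points depend
measurably on the points. -/
def HasMeasurableSup {X : Type*} [MeasurableSpace X] {C : ℕ}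
    (G : Set (X → EuclideanSpace ℝ (Fin C))) : Prop :=
  ∀ (J : Type) [Fintype J] (Φ : (J → EuclideanSpace ℝ (Fin C)) → ℝ), Continuous Φ →
    (∀ y : J → X, BddAbove (Set.range fun g : G => Φ fun j => g.1 (y j))) →
    Measurable fun y : J → X => ⨆ g : G, Φ fun j => g.1 (y j)

section Bound

variable {X : Type*} [MeasurableSpace X] {C N : ℕ} {M : Setting X C N}

lemma measurable_of_mem_productClass {F : Set (X → ℝ)} (hF : ∀ f ∈ F, Measurable f)
    {g : X → EuclideanSpace ℝ (Fin C)} (hg : g ∈ productClass C F) : Measurable g := by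
  have h : Measurable fun x => (WithLp.ofLp (g x)) := measurable_pi_lambda _ fun c => hF _ (hg c)
  exact (WithLp.measurable_toLp 2 (Fin C → ℝ)).comp h

/-- The contraction principle for the losses: the Rademacher averages of the weighted losses of
a product class are bounded by those of its factor. -/
lemma radLE_weight_mul_lam {F : Set (X → ℝ)} {B : ℝ}
    (hrad : ∀ (x : M.Index → X) (b : M.Index → ℝ),
      RadLE (fun s (f : F) => b s * f.1 (x s)) (B * √(∑ s, b s ^ 2)))
    (hV : ∀ g ∈ productClass C F, ∀ x, g x ∈ M.V) (x : M.Index → X) :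
    RadLE (fun s (g : productClass C F) =>
        M.weight s * M.lam s.1 (g.1 (x s)) s.2.1 - M.weight s * M.lam s.1 0 s.2.1)
      (2 * (C * (B * ((⨆ i, lipConst M.V (M.lam i)) * √(∑ s, M.weight s ^ 2))))) := by
  set L := ⨆ i, lipConst M.V (M.lam i) with hL
  have hL0 : 0 ≤ L := Real.iSup_nonneg fun i => lipConst_nonneg
  have hLi : ∀ i, lipConst M.V (M.lam i) ≤ L := fun i =>
    le_ciSup (f := fun i => lipConst M.V (M.lam i)) (Set.finite_range _).bddAbove i
  have hb := hrad x fun s => M.weight s * L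
  refine RadLE.vector_contraction (κ := Fin C)
    (ψ := fun s c (g : productClass C F) => M.weight s * L * g.1 (x s) c) ?_ fun t => ?_
  · intro s g g'
    have h1 : √(∑ c, (M.weight s * L * g.1 (x s) c - M.weight s * L * g'.1 (x s) c) ^ 2) =
        M.weight s * L * ‖g.1 (x s) - g'.1 (x s)‖ := by
      rw [EuclideanSpace.norm_eq]
      simp only [← mul_sub, mul_pow, ← mul_sum, PiLp.sub_apply, Real.norm_eq_abs, sq_abs]
      rw [← mul_pow, Real.sqrt_mul (sq_nonneg _),
        Real.sqrt_sq (mul_nonneg (M.weight_nonneg s) hL0)]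
    rw [h1, sub_sub_sub_cancel_right, ← mul_sub, abs_mul, abs_of_nonneg (M.weight_nonneg s),
      mul_assoc]
    refine mul_le_mul_of_nonneg_left ?_ (M.weight_nonneg s)
    exact ((M.isLipConst_lam s.1).2 s.2.1 _ (hV _ g.2 _) _ (hV _ g'.2 _)).trans
      (mul_le_mul_of_nonneg_right (hLi _) (norm_nonneg _))
  · have h := hb.sum_coord (T := productClass C F) (κ := Fin C)
      (fun c g => ⟨fun x => g.1 x c, g.2 c⟩) t
    have hs : √(∑ s, (M.weight s * L) ^ 2) = L * √(∑ s, M.weight s ^ 2) := by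
      simp only [mul_pow, ← sum_mul]
      rw [mul_comm, Real.sqrt_mul (sq_nonneg _), Real.sqrt_sq hL0]
    rw [hs, Fintype.card_fin] at h
    exact h

/-- The largest difference between the empirical risks of two samples is measurable. -/
lemma measurable_maxDiff_lam {G : Set (X → EuclideanSpace ℝ (Fin C))} (hG : HasMeasurableSup G)
    (hV : ∀ g ∈ G, ∀ x, g x ∈ M.V) {B : M.Index → ℝ}
    (hB : ∀ s (g : G) x, |M.weight s * M.lam s.1 (g.1 x) s.2.1| ≤ B s) :
    Measurable (maxDiff fun (s : M.Index) (g : G) x => M.weight s * M.lam s.1 (g.1 x) s.2.1) := by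
  choose Λ hΛ heq using M.exists_continuous_eq_lam
  let Φ : (M.Index ⊕ M.Index → EuclideanSpace ℝ (Fin C)) → ℝ := fun v =>
    |∑ s : M.Index, (M.weight s * Λ s.1 s.2.1 (v (.inl s)) - M.weight s * Λ s.1 s.2.1 (v (.inr s)))|
  have hΦ : Continuous Φ := by
    refine (continuous_finsetSum _ fun s _ => ?_).abs
    have := hΛ s.1 s.2.1
    fun_prop
  let y : (M.Index → X × X) → M.Index ⊕ M.Index → X := fun z =>
    Sum.elim (fun s => (z s).1) fun s => (z s).2
  have hy : Measurable y := measurable_pi_lambda _ fun j => by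
    rcases j with s | s
    · exact measurable_fst.comp (measurable_pi_apply s)
    · exact measurable_snd.comp (measurable_pi_apply s)
  have hΦy : ∀ (g : G) (y : M.Index ⊕ M.Index → X), Φ (fun j => g.1 (y j)) =
      |∑ s : M.Index, (M.weight s * M.lam s.1 (g.1 (y (.inl s))) s.2.1
        - M.weight s * M.lam s.1 (g.1 (y (.inr s))) s.2.1)| := by
    intro g y
    simp only [Φ, heq _ _ _ (hV _ g.2 _)]
  have h := (hG _ Φ hΦ fun y => ⟨∑ s, (B s + B s), by
    rintro _ ⟨g, rfl⟩
    simp only [hΦy]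
    exact abs_sum_sub_le hB g fun s => (y (.inl s), y (.inr s))⟩).comp hy
  simp only [comp_def, hΦy] at h
  exact h

/-- The generalization error bound for the product of copies of a class `F` whose Rademacher
averages are bounded by `B`. The constant `8` is the product of `4` from symmetrization and `2` from
Khintchine's inequality. -/
theorem generalization_error_bound {F : Set (X → ℝ)} {A B : ℝ} (hB : 0 ≤ B)
    (h0 : (fun _ => 0) ∈ F) (hF : ∀ f ∈ F, Measurable f)
    (hsup : HasMeasurableSup (productClass C F))
    (hrad : ∀ (x : M.Index → X) (b : M.Index → ℝ),
      RadLE (fun s (f : F) => b s * f.1 (x s)) (B * √(∑ s, b s ^ 2)))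
    (hV : ∀ g ∈ productClass C F, ∀ x, g x ∈ M.V)
    (hA : ∀ g ∈ productClass C F, ∀ x, ‖g x‖ ≤ A)
    {Ω : Type*} [MeasurableSpace Ω] (Pr : Measure Ω) [IsProbabilityMeasure Pr]
    (S : M.Index → Ω → X) (hS : M.IsSample Pr S) :
    (∀ g ∈ productClass C F,
      Integrable (fun ω => M.empRisk (fun s => S s ω) g) Pr ∧
      ∫ ω, M.empRisk (fun s => S s ω) g ∂Pr = M.aggRisk g) ∧
    ∀ δ : ℝ, 0 < δ → δ ≤ 1 →
      ∃ E : Set Ω, MeasurableSet E ∧ ENNReal.ofReal (1 - δ) ≤ Pr E ∧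
        ∀ ω ∈ E, ∀ g ∈ productClass C F,
          |M.empRisk (fun s => S s ω) g - M.aggRisk g| ≤ M.bound A (8 * B) δ := by
  have hg0 : (fun _ => 0 : X → EuclideanSpace ℝ (Fin C)) ∈ productClass C F := fun c => h0
  have hX : Nonempty X := by
    have := M.isProb
    obtain ⟨z⟩ := nonempty_of_isProbabilityMeasure M.P
    exact ⟨z.1⟩
  have hV0 : (0 : EuclideanSpace ℝ (Fin C)) ∈ M.V := hV _ hg0 hX.some
  set K := ⨆ i, (lipConst M.V (M.lam i) * A + absAtZero (M.lam i)) with hK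
  have hlam : ∀ g ∈ productClass C F, ∀ i c x, |M.lam i (g x) c| ≤ K := fun g hg i c x =>
    M.abs_lam_le hV0 i c (hV g hg x) (hA g hg x)
  have hm := fun g (hg : g ∈ productClass C F) => measurable_of_mem_productClass hF hg
  refine ⟨fun g hg => Setting.integral_empRisk hS (hm g hg) (hV g hg) (hlam g hg),
    fun δ hδ hδ1 => ?_⟩
  let φ : M.Index → productClass C F → X → ℝ := fun s g x =>
    M.weight s * M.lam s.1 (g.1 x) s.2.1
  have hφM : ∀ s g x, |φ s g x| ≤ M.weight s * K := fun s g x => by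
    rw [abs_mul, abs_of_nonneg (M.weight_nonneg s)]
    exact mul_le_mul_of_nonneg_left (hlam g.1 g.2 _ _ _) (M.weight_nonneg s)
  have hlaw : Pr.map (fun ω s => S s ω) = Measure.pi M.law := by
    rw [(iIndepFun_iff_map_fun_eq_pi_map fun s => (hS.measurable s).aemeasurable).1 hS.indep]
    congr 1
    ext1 s
    exact hS.law s
  obtain ⟨E, hE, hPE, hbound⟩ := exists_event_uniform_deviation_le M.law hφM
    (fun s g => (Setting.measurable_lam_comp (hm g.1 g.2) (hV g.1 g.2) _ _).const_mul _)
    (measurable_maxDiff_lam hsup hV hφM) (t₀ := ⟨_, hg0⟩)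
    (d := fun s => M.weight s * M.lam s.1 0 s.2.1) (fun s x => rfl)
    (radLE_weight_mul_lam hrad hV) Pr
    (measurable_pi_lambda _ fun s => hS.measurable s) hlaw hδ hδ1
  refine ⟨E, hE, hPE, fun ω hω g hg => ?_⟩
  rw [M.empRisk_eq_sum, Setting.aggRisk_eq_sum (hm g hg) (hV g hg) (hlam g hg)]
  refine (hbound ω hω ⟨g, hg⟩).trans ?_
  have hK0 : 0 ≤ K := Real.iSup_nonneg fun i => add_nonneg
    (mul_nonneg lipConst_nonneg ((norm_nonneg _).trans (hA _ hg0 hX.some)))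
    (Real.iSup_nonneg fun c => abs_nonneg _)
  have hL0 : 0 ≤ ⨆ i, lipConst M.V (M.lam i) := Real.iSup_nonneg fun i => lipConst_nonneg
  have hsq : √(∑ s, (M.weight s * K) ^ 2) = K * √(∑ s, M.weight s ^ 2) := by
    simp only [mul_pow, ← sum_mul]
    rw [mul_comm, Real.sqrt_mul (sq_nonneg _), Real.sqrt_sq hK0]
  rw [hsq, Setting.bound]
  have hle := Real.sqrt_le_sqrt M.sum_weight_sq_le
  calc _ = (K * √(2 * Real.log (2 / δ)) + C * (8 * B) * ⨆ i, lipConst M.V (M.lam i)) *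
        √(∑ s, M.weight s ^ 2) := by ring
    _ ≤ _ := mul_le_mul_of_nonneg_left hle (by positivity)

end Bound

/-! ### Balls in a reproducing kernel Hilbert space -/

lemma zero_mem_rkhsBall {X H : Type*} [NormedAddCommGroup H] [InnerProductSpace ℝ H]
    [RKHS ℝ H X ℝ] {R : ℝ} (hR : 0 ≤ R) : (fun _ => 0 : X → ℝ) ∈ rkhsBall H R :=
  ⟨0, by simpa using hR, fun x => by simp⟩

section RKHSBall

variable {X : Type*} {H : Type*} [NormedAddCommGroup H] [InnerProductSpace ℝ H] [CompleteSpace H]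
  [RKHS ℝ H X ℝ]

lemma inner_kerFun_one (x : X) (h : H) : inner ℝ (RKHS.kerFun H x 1) h = h x := by
  rw [RKHS.kerFun_inner]
  simp

lemma kerFun_eq_smul_one (x : X) (v : ℝ) : RKHS.kerFun H x v = v • RKHS.kerFun H x 1 := by
  rw [← map_smul, smul_eq_mul, mul_one]

lemma inner_kerFun_kerFun {k : X → X → ℝ} (hk : ∀ x y, RKHS.kernel H x y 1 = k x y) (x y : X) :
    inner ℝ (RKHS.kerFun H x 1) (RKHS.kerFun H y 1) = k x y := by
  rw [inner_kerFun_one, RKHS.kerFun_apply, hk]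

/-- The functions in the reproducing kernel Hilbert space of a measurable kernel are measurable,
as pointwise limits of combinations of kernel functions. -/
lemma measurable_rkhs [MeasurableSpace X] {k : X → X → ℝ}
    (hk : ∀ x y, RKHS.kernel H x y 1 = k x y) (hkm : Measurable fun p : X × X => k p.1 p.2)
    (h : H) : Measurable (h : X → ℝ) := by
  have hspan : ∀ f ∈ Submodule.span ℝ {RKHS.kerFun H x v | (x : X) (v : ℝ)},
      Measurable (f : X → ℝ) := by
    intro f hf
    induction hf using Submodule.span_induction with
    | mem f hf =>
      obtain ⟨x, v, rfl⟩ := hf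
      have : (RKHS.kerFun H x v : X → ℝ) = fun y => v * k y x := by
        ext y
        rw [kerFun_eq_smul_one, RKHS.coe_smul, Pi.smul_apply, RKHS.kerFun_apply, hk, smul_eq_mul]
      rw [this]
      exact (hkm.comp measurable_prodMk_right).const_mul v
    | zero => simpa using measurable_zero
    | add f g _ _ hf hg => simpa using hf.add hg
    | smul c f _ hf => simpa using hf.const_smul c
  have hmem : h ∈ closure (Submodule.span ℝ {RKHS.kerFun H x v | (x : X) (v : ℝ)} : Set H) := by
    rw [← Submodule.topologicalClosure_coe, RKHS.kerFun_dense]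
    trivial
  obtain ⟨f, hf, hlim⟩ := mem_closure_iff_seq_limit.1 hmem
  refine measurable_of_tendsto_metrizable (fun n => hspan _ (hf n)) (tendsto_pi_nhds.2 fun x => ?_)
  exact ((RKHS.continuous_eval (𝕜 := ℝ) (H := H) x).tendsto h).comp hlim

/-- The radial retraction of a normed space onto the ball of radius `R`. -/
noncomputable def ballRetract {E : Type*} [NormedAddCommGroup E] [NormedSpace ℝ E] (R : ℝ)
    (z : E) : E :=
  (R / max R ‖z‖) • z

section

variable {E : Type*} [NormedAddCommGroup E] [NormedSpace ℝ E] {R : ℝ}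

lemma norm_ballRetract_le (hR : 0 ≤ R) (z : E) : ‖ballRetract R z‖ ≤ R := by
  have hm : 0 ≤ max R ‖z‖ := hR.trans (le_max_left _ _)
  rw [ballRetract, norm_smul, Real.norm_eq_abs, abs_of_nonneg (div_nonneg hR hm), div_mul_eq_mul_div,
    mul_div_assoc]
  exact mul_le_of_le_one_right hR (div_le_one_of_le₀ (le_max_right _ _) hm)

lemma ballRetract_eq_self {z : E} (hz : ‖z‖ ≤ R) : ballRetract R z = z := by
  rw [ballRetract, max_eq_left hz]
  rcases eq_or_ne R 0 with rfl | hR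
  · rw [norm_le_zero_iff.1 hz, smul_zero]
  · rw [div_self hR, one_smul]

lemma continuous_ballRetract (hR : 0 ≤ R) : Continuous (ballRetract R : E → E) := by
  unfold ballRetract
  rcases hR.eq_or_lt with rfl | hR
  · simpa using continuous_const
  · exact (continuous_const.div (continuous_const.max continuous_norm)
      fun z => (hR.trans_le (le_max_left _ _)).ne').smul continuous_id

end

/-- The function to `ℝ^C` whose coordinate `c` is the combination of the kernel functions at the
points `y` with coefficients `r c`, retracted to the ball of radius `R` of `H`. -/
noncomputable def ballCombination {J : Type*} [Fintype J] {C : ℕ} (H : Type*)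
    [NormedAddCommGroup H] [InnerProductSpace ℝ H] [CompleteSpace H] [RKHS ℝ H X ℝ] (R : ℝ)
    (y : J → X) (r : Fin C → J → ℝ) : X → EuclideanSpace ℝ (Fin C) :=
  fun x => WithLp.toLp 2 fun c => ballRetract R (∑ j, r c j • RKHS.kerFun H (y j) 1) x

section

variable {J : Type*} [Fintype J] {C : ℕ} {R : ℝ}

lemma ballCombination_mem (hR : 0 ≤ R) (y : J → X) (r : Fin C → J → ℝ) :
    ballCombination H R y r ∈ productClass C (rkhsBall H R) :=
  fun _ => ⟨_, norm_ballRetract_le hR _, fun _ => rfl⟩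

lemma continuous_ballCombination (hR : 0 ≤ R) (y : J → X) (x : X) :
    Continuous fun r : Fin C → J → ℝ => ballCombination H R y r x := by
  refine (PiLp.continuous_toLp 2 _).comp (continuous_pi fun c => ?_)
  refine (RKHS.continuous_eval (𝕜 := ℝ) (H := H) x).comp ((continuous_ballRetract hR).comp ?_)
  fun_prop

/-- At the points `y`, every member of the product of balls agrees with a combination of the kernel
functions at these points, by orthogonal projection to their span. -/
lemma exists_ballCombination_eq (y : J → X) {g : X → EuclideanSpace ℝ (Fin C)}
    (hg : g ∈ productClass C (rkhsBall H R)) :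
    ∃ r : Fin C → J → ℝ, ∀ i, ballCombination H R y r (y i) = g (y i) := by
  choose h hhR hh using hg
  let U := Submodule.span ℝ (Set.range fun j => RKHS.kerFun H (y j) 1)
  have : FiniteDimensional ℝ U := FiniteDimensional.span_of_finite ℝ (Set.finite_range _)
  have hr : ∀ c, ∃ r : J → ℝ, ∑ j, r j • RKHS.kerFun H (y j) 1 = U.starProjection (h c) :=
    fun c => (Submodule.mem_span_range_iff_exists_fun ℝ).1 (U.starProjection_apply_mem (h c))
  choose r hr using hr
  refine ⟨r, fun i => ?_⟩
  ext c
  have hi : RKHS.kerFun H (y i) 1 ∈ U := Submodule.subset_span ⟨i, rfl⟩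
  have hn : ‖U.starProjection (h c)‖ ≤ R := (U.norm_starProjection_apply_le _).trans (hhR c)
  change ballRetract R (∑ j, r c j • RKHS.kerFun H (y j) 1) (y i) = _
  rw [hr, ballRetract_eq_self hn, ← inner_kerFun_one,
    show (g (y i)).ofLp c = h c (y i) from hh c (y i), ← inner_kerFun_one,
    ← Submodule.inner_starProjection_left_eq_right, Submodule.starProjection_eq_self_iff.2 hi]

variable [MeasurableSpace X] {k : X → X → ℝ}

lemma measurable_ballCombination (hk : ∀ x y, RKHS.kernel H x y 1 = k x y)
    (hkm : Measurable fun p : X × X => k p.1 p.2) (r : Fin C → J → ℝ) (i : J) :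
    Measurable fun y : J → X => ballCombination H R y r (y i) := by
  have hkij : ∀ i j, Measurable fun y : J → X => k (y i) (y j) := fun i j =>
    Measurable.comp (f := fun y : J → X => (y i, y j)) hkm
      ((measurable_pi_apply i).prodMk (measurable_pi_apply j))
  refine (WithLp.measurable_toLp 2 (Fin C → ℝ)).comp (measurable_pi_lambda _ fun c => ?_)
  have hnorm : ∀ y : J → X, ‖∑ j, r c j • RKHS.kerFun H (y j) 1‖ =
      √(∑ i, ∑ j, r c j * (r c i * k (y i) (y j))) := fun y => by
    rw [norm_eq_sqrt_real_inner, sum_inner]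
    simp only [inner_sum, real_inner_smul_left, real_inner_smul_right, inner_kerFun_kerFun hk]
  have hval : ∀ y : J → X, ballRetract R (∑ j, r c j • RKHS.kerFun H (y j) 1) (y i) =
      R / max R (√(∑ i, ∑ j, r c j * (r c i * k (y i) (y j)))) * ∑ j, r c j * k (y i) (y j) :=
    fun y => by
      rw [← inner_kerFun_one, ballRetract, real_inner_smul_right, hnorm, inner_sum]
      simp only [real_inner_smul_right, inner_kerFun_kerFun hk]
  simp only [hval]
  fun_prop

end

/-- The supremum may be taken over the combinations of the kernel functions at the given points
whose coefficients belong to a countable dense set, even if the Hilbert space is not separable. -/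
lemma hasMeasurableSup_rkhsBall [MeasurableSpace X] {C : ℕ} {k : X → X → ℝ}
    (hk : ∀ x y, RKHS.kernel H x y 1 = k x y) (hkm : Measurable fun p : X × X => k p.1 p.2)
    {R : ℝ} (hR : 0 ≤ R) : HasMeasurableSup (productClass C (rkhsBall H R : Set (X → ℝ))) := by
  intro J _ Φ hΦ hbdd
  have : Nonempty (productClass C (rkhsBall H R : Set (X → ℝ))) :=
    ⟨⟨fun _ => 0, fun c => zero_mem_rkhsBall hR⟩⟩
  let q := TopologicalSpace.denseSeq (Fin C → J → ℝ)
  have hq : ∀ (y : J → X) n, Φ (fun i => ballCombination H R y (q n) (y i)) ≤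
      ⨆ g : productClass C (rkhsBall H R : Set (X → ℝ)), Φ fun i => g.1 (y i) := fun y n =>
    le_ciSup (hbdd y) ⟨_, ballCombination_mem hR y (q n)⟩
  have heq : (fun y : J → X => ⨆ g : productClass C (rkhsBall H R : Set (X → ℝ)),
      Φ fun i => g.1 (y i)) = fun y => ⨆ n, Φ fun i => ballCombination H R y (q n) (y i) := by
    ext y
    refine le_antisymm (ciSup_le fun g => ?_) (ciSup_le (hq y))
    obtain ⟨r, hr⟩ := exists_ballCombination_eq y g.2
    simp only [← hr]
    refine (TopologicalSpace.denseRange_denseSeq (Fin C → J → ℝ)).induction_on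
      (p := fun r => Φ (fun i => ballCombination H R y r (y i)) ≤ _) r ?_ fun n => ?_
    · exact isClosed_le (hΦ.comp (continuous_pi fun i => continuous_ballCombination hR y (y i)))
        continuous_const
    · exact le_ciSup (f := fun n => Φ fun i => ballCombination H R y (q n) (y i))
        ⟨_, by rintro _ ⟨n, rfl⟩; exact hq y n⟩ n
  rw [heq]
  exact Measurable.iSup fun n => hΦ.measurable.comp
    (measurable_pi_lambda _ fun i => measurable_ballCombination hk hkm (q n) i)

lemma radLE_rkhsBall {ι : Type*} [Fintype ι] [DecidableEq ι] {K R : ℝ}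
    (hK : ∀ x : X, ‖RKHS.kerFun H x 1‖ ≤ K) (hK0 : 0 ≤ K) (hR : 0 ≤ R) (x : ι → X) (b : ι → ℝ) :
    RadLE (fun s (f : (rkhsBall H R : Set (X → ℝ))) => b s * f.1 (x s))
      (R * K * √(∑ s, b s ^ 2)) := by
  choose h hhR hh using fun f : (rkhsBall H R : Set (X → ℝ)) => f.2
  have := RadLE.of_inner hR hK0 hhR (fun s => hK (x s)) b
  simpa only [inner_kerFun_one, ← hh] using this

end RKHSBall

/-! ### Multilayer perceptrons -/

lemma hasMeasurableSup_of_continuous {X : Type*} [TopologicalSpace X]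
    [SecondCountableTopology X] [MeasurableSpace X] [BorelSpace X] {C : ℕ}
    {G : Set (X → EuclideanSpace ℝ (Fin C))} (hG : ∀ g ∈ G, Continuous g) :
    HasMeasurableSup G := by
  intro J _ Φ hΦ hbdd
  refine (lowerSemicontinuous_ciSup hbdd fun g => Continuous.lowerSemicontinuous ?_).measurable
  exact hΦ.comp (continuous_pi fun j => (hG g.1 g.2).comp (continuous_apply j))

section MLP

variable {d : ℕ} {D : Set (EuclideanSpace ℝ (Fin d))} {μ : ℝ → ℝ} {a β : ℝ}

lemma zero_mem_mlp (hβ : 0 ≤ β) (m : ℕ) : (fun _ => 0 : D → ℝ) ∈ mlp D μ β (m + 1) := by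
  induction m with
  | zero => exact ⟨0, by simpa using hβ, fun x => by simp⟩
  | succ m ih => exact ⟨0, fun _ _ => 0, by simpa using hβ, fun _ => ih, fun x => by simp⟩

lemma continuous_of_mem_mlp (hμ : Continuous μ) (m : ℕ) :
    ∀ f ∈ mlp D μ β (m + 1), Continuous f := by
  induction m with
  | zero =>
    rintro f ⟨v, -, hf⟩
    rw [funext hf]
    fun_prop
  | succ m ih =>
    rintro f ⟨v, h, -, hh, hf⟩
    rw [funext hf]
    have := fun j => ih _ (hh j)
    fun_prop

/-- The Rademacher averages of perceptrons grow by a factor `2 β` with each layer: a combination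
with coefficients of 1-norm at most `β` is dominated by `β` times the absolute value of one of its
terms, and the activation function is a contraction. -/
lemma radLE_mlp {ι : Type*} [Fintype ι] [DecidableEq ι] (ha : ∀ x ∈ D, ‖x‖ ≤ a) (ha0 : 0 ≤ a)
    (hβ : 0 ≤ β) (hμ : LipschitzWith 1 μ)
    (h0 : ∀ p, 1 ≤ p → ∃ f ∈ mlp D μ β p, ∀ x, μ (f x) = 0) (x : ι → D) (b : ι → ℝ) (m : ℕ) :
    RadLE (fun s (f : mlp D μ β (m + 1)) => b s * f.1 (x s))
      (β * a * (2 * β) ^ m * √(∑ s, b s ^ 2)) := by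
  induction m with
  | zero =>
    choose v hv hf using fun f : mlp D μ β 1 => f.2
    have := RadLE.of_inner hβ ha0 hv (fun s => ha _ (x s).2) b
    simpa only [pow_zero, mul_one, ← hf] using this
  | succ m ih =>
    set B := β * a * (2 * β) ^ m * √(∑ s, b s ^ 2) with hB
    have hact : RadLE (fun s (f : mlp D μ β (m + 1)) => b s * μ (f.1 (x s))) B := by
      refine ih.comp_lipschitz fun s f f' => ?_
      rw [← mul_sub, ← mul_sub, abs_mul, abs_mul]
      refine mul_le_mul_of_nonneg_left ?_ (abs_nonneg _)
      simpa [Real.dist_eq] using hμ.dist_le_mul (f.1 (x s)) (f'.1 (x s))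
    obtain ⟨f₀, hf₀, hμf₀⟩ := h0 (m + 1) (by omega)
    intro t
    have hex : ∀ ε : ι → ℤˣ, ∃ u : mlp D μ β (m + 1),
        ∑ s, sgn (ε s) * (b s * (t ε).1 (x s)) ≤
          β * |∑ s, sgn (ε s) * (b s * μ (u.1 (x s)))| := by
      intro ε
      obtain ⟨v, h, hv, hh, hf⟩ := (t ε).2
      let Z : mlp D μ β (m + 1) → ℝ := fun u => |∑ s, sgn (ε s) * (b s * μ (u.1 (x s)))|
      obtain ⟨u, hu⟩ : ∃ u, ∀ j, Z ⟨h j, hh j⟩ ≤ Z u := by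
        cases isEmpty_or_nonempty (Fin d)
        · exact ⟨⟨f₀, hf₀⟩, fun j => isEmptyElim j⟩
        · obtain ⟨j, hj⟩ := Finite.exists_max fun j => Z ⟨h j, hh j⟩
          exact ⟨_, hj⟩
      refine ⟨u, ?_⟩
      calc ∑ s, sgn (ε s) * (b s * (t ε).1 (x s))
          = ∑ j, v j * ∑ s, sgn (ε s) * (b s * μ (h j (x s))) := by
            simp only [hf, mul_sum]
            rw [sum_comm]
            exact sum_congr rfl fun j _ => sum_congr rfl fun s _ => by ring
        _ ≤ ∑ j, |v j| * Z u := sum_le_sum fun j _ => (le_abs_self _).trans (by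
            rw [abs_mul]
            exact mul_le_mul_of_nonneg_left (hu j) (abs_nonneg _))
        _ ≤ β * Z u := by
            rw [← sum_mul]
            exact mul_le_mul_of_nonneg_right hv (abs_nonneg _)
    choose u hu using hex
    have habs := hact.expect_abs_le (t₀ := ⟨f₀, hf₀⟩) (fun s => by simp [hμf₀]) u
    calc _ ≤ 𝔼 ε : ι → ℤˣ, β * |∑ s, sgn (ε s) * (b s * μ ((u ε).1 (x s)))| :=
          expect_le_expect fun ε _ => hu ε
      _ ≤ β * (2 * B) := by
          rw [← mul_expect]
          exact mul_le_mul_of_nonneg_left habs hβ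
      _ = _ := by
          rw [hB]
          ring

end MLP

end LMNTM

theorem theorem3 :
    -- balls in a reproducing kernel Hilbert space
    (∃ B₁ : ℝ → ℝ → ℝ,
      ∀ {X : Type u} [MeasurableSpace X] {C N : ℕ} (M : LMNTM.Setting X C N)
        {H : Type v} [NormedAddCommGroup H] [InnerProductSpace ℝ H] [CompleteSpace H]
        [RKHS ℝ H X ℝ] (k : X → X → ℝ) (K R A : ℝ),
        (∀ x y, RKHS.kernel H x y 1 = k x y) →
        Measurable (fun p : X × X => k p.1 p.2) →
        (∀ x, ‖RKHS.kerFun H x 1‖ ≤ K) →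
        0 ≤ R →
        (∀ g ∈ LMNTM.productClass C (LMNTM.rkhsBall H R), ∀ x, g x ∈ M.V) →
        (∀ g ∈ LMNTM.productClass C (LMNTM.rkhsBall H R), ∀ x, ‖g x‖ ≤ A) →
        ∀ {Ω : Type w} [MeasurableSpace Ω] (Pr : Measure Ω) [IsProbabilityMeasure Pr]
          (S : M.Index → Ω → X), M.IsSample Pr S →
          (∀ g ∈ LMNTM.productClass C (LMNTM.rkhsBall H R),
            Integrable (fun ω => M.empRisk (fun s => S s ω) g) Pr ∧
            ∫ ω, M.empRisk (fun s => S s ω) g ∂Pr = M.aggRisk g) ∧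
          ∀ δ : ℝ, 0 < δ → δ ≤ 1 →
            ∃ E : Set Ω, MeasurableSet E ∧ ENNReal.ofReal (1 - δ) ≤ Pr E ∧
              ∀ ω ∈ E, ∀ g ∈ LMNTM.productClass C (LMNTM.rkhsBall H R),
                |M.empRisk (fun s => S s ω) g - M.aggRisk g| ≤ M.bound A (B₁ K R) δ) ∧
    -- multilayer perceptrons
    (∃ B₂ : ℝ → ℕ → ℝ → ℝ,
      ∀ {d C N : ℕ} (D : Set (EuclideanSpace ℝ (Fin d))) (M : LMNTM.Setting D C N)
        (μ : ℝ → ℝ) (a β A : ℝ) (m : ℕ),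
        (∀ x ∈ D, ‖x‖ ≤ a) →
        0 < β →
        1 ≤ m →
        LipschitzWith 1 μ →
        (∀ p, 1 ≤ p → ∃ f ∈ LMNTM.mlp D μ β p, ∀ x, μ (f x) = 0) →
        (∀ g ∈ LMNTM.productClass C (LMNTM.mlp D μ β m), ∀ x, g x ∈ M.V) →
        (∀ g ∈ LMNTM.productClass C (LMNTM.mlp D μ β m), ∀ x, ‖g x‖ ≤ A) →
        ∀ {Ω : Type w} [MeasurableSpace Ω] (Pr : Measure Ω) [IsProbabilityMeasure Pr]
          (S : M.Index → Ω → D), M.IsSample Pr S →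
          (∀ g ∈ LMNTM.productClass C (LMNTM.mlp D μ β m),
            Integrable (fun ω => M.empRisk (fun s => S s ω) g) Pr ∧
            ∫ ω, M.empRisk (fun s => S s ω) g ∂Pr = M.aggRisk g) ∧
          ∀ δ : ℝ, 0 < δ → δ ≤ 1 →
            ∃ E : Set Ω, MeasurableSet E ∧ ENNReal.ofReal (1 - δ) ≤ Pr E ∧
              ∀ ω ∈ E, ∀ g ∈ LMNTM.productClass C (LMNTM.mlp D μ β m),
                |M.empRisk (fun s => S s ω) g - M.aggRisk g| ≤ M.bound A (B₂ a m β) δ) := by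
  constructor
  · refine ⟨fun K R => 8 * (R * K), ?_⟩
    intro X _ C N M H _ _ _ _ k K R A hk hkm hK hR hV hA Ω _ Pr _ S hS
    have hK0 : 0 ≤ K := by
      have := M.isProb
      obtain ⟨z⟩ := nonempty_of_isProbabilityMeasure M.P
      exact (norm_nonneg _).trans (hK z.1)
    refine LMNTM.generalization_error_bound (mul_nonneg hR hK0) (LMNTM.zero_mem_rkhsBall hR)
      ?_ (LMNTM.hasMeasurableSup_rkhsBall hk hkm hR)
      (LMNTM.radLE_rkhsBall hK hK0 hR) hV hA Pr S hS
    rintro f ⟨h, -, hf⟩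
    rw [funext hf]
    exact LMNTM.measurable_rkhs hk hkm h
  · refine ⟨fun a m β => 8 * (β * a * (2 * β) ^ (m - 1)), ?_⟩
    intro d C N D M μ a β A m ha hβ hm hμ h0 hV hA Ω _ Pr _ S hS
    obtain ⟨m, rfl⟩ := Nat.exists_eq_add_of_le' hm
    have ha0 : 0 ≤ a := by
      have := M.isProb
      obtain ⟨z⟩ := nonempty_of_isProbabilityMeasure M.P
      exact (norm_nonneg _).trans (ha z.1 z.1.2)
    have hcont := LMNTM.continuous_of_mem_mlp (D := D) (β := β) hμ.continuous m
    beta_reduce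
    rw [Nat.add_sub_cancel]
    refine LMNTM.generalization_error_bound (by positivity) (LMNTM.zero_mem_mlp hβ.le m)
      (fun f hf => (hcont f hf).measurable)
      (LMNTM.hasMeasurableSup_of_continuous fun g hg => ?_)
      (fun x b => LMNTM.radLE_mlp ha ha0 hβ.le hμ h0 x b m) hV hA Pr S hS
    exact (PiLp.continuous_toLp 2 _).comp (continuous_pi fun c => hcont _ (hg c))
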